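/- Let $m\ge 2$, $\Omega=[-\tfrac12,\tfrac12]^m$, $\varepsilon>0$, $\tau>0$ and $\kappa\ge 3m-1$. For $U\in\mathbb R^{m\times m}$ put $f(U)=U-UU^{T}U$, $F(U)=\tfrac14(U^{T}U-I)^2$ and $\mathcal N[U]=\kappa U+f(U)$; let $\langle A,B\rangle_F=\operatorname{tr}(A^{T}B)$ and $\|\cdot\|_F$ be the Frobenius inner product and norm, and let $L=\kappa\mathcal I-\varepsilon^2\Delta$ with periodic boundary conditions on $\Omega$, so that $e^{-tL}=e^{-\kappa t}e^{t\varepsilon^2\Delta}$ with $e^{t\Delta}$ the periodic heat semigroup. Let $U_0:\Omega\to\mathbb R^{m\times m}$ be continuous and periodic with $\|U_0(x)\|_F\le\sqrt m$ for all $x$. Let $(U^n)_{n\ge0}$, $U^0=U_0$, be generated either by the ETD1 scheme $$U^{n+1}=e^{-\tau L}U^n+\int_0^\tau e^{-(\tau-s)L}\mathcal N[U^n]\,ds=e^{-\tau L}U^n+(\mathcal I-e^{-\tau L})L^{-1}\mathcal N[U^n],$$ or by the ETDRK2 scheme $$U^{n+1}=e^{-\tau L}U^n+\int_0^\tau e^{-(\tau-s)L}\Big(\big(1-\tfrac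 s\tau\big)\mathcal N[U^n]+\tfrac s\tau\,\mathcal N[\widetilde U^{n+1}]\Big)ds=\widetilde U^{n+1}-\tfrac1\tau\big(e^{-\tau L}-\mathcal I+\tau L\big)L^{-2}\big(\mathcal N[U^n]-\mathcal N[\widetilde U^{n+1}]\big),$$ where $\widetilde U^{n+1}=e^{-\tau L}U^n+(\mathcal I-e^{-\tau L})L^{-1}\mathcal N[U^n]$. Then, in both cases, $$E(U^{n+1})\le E(U^n)\qquad\text{for all } n\ge 0,$$ where $$E(U)=\int_\Omega\Big(\tfrac{\varepsilon^2}{2}\|\nabla U\|_F^2+\langle F(U),I\rangle_F\Big)dx\in[0,\infty],\qquad \|\nabla U\|_F^2=\sum_{i,j=1}^m|\nabla U_{ij}|^2,$$ with $\nabla U$ the weak gradient of the periodic field $U$, and $E(U)=\infty$ if $U$ has no square-integrable weak gradient. Moreover, for all $U_1,U_2\in\mathbb R^{m\times m}$ with $\|U_1\|_F,\|U_2\|_F\le\sqrt m$, $$\langle F(U_1)-F(U_2),I\rangle_F+\langle U_1-U_2,f(U_2)\rangle_F\le\tfrac\kappa2\|U_1-U_2\|_F^2 .$$ -/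

import Mathlib

open scoped ENNReal ContDiff Matrix.Norms.Frobenius

noncomputable section

namespace MatrixAllenCahn

/-- Real `m × m` matrices. Throughout, `‖·‖` on matrices is the Frobenius norm. -/
abbrev Mat (m : ℕ) : Type := Matrix (Fin m) (Fin m) ℝ

/-- Matrix-valued fields on `ℝ^m`. The periodic boundary condition on `Ω` is expressed by
taking fields on `ℝ^m` that have period one in every coordinate. -/
abbrev Field (m : ℕ) : Type := (Fin m → ℝ) → Mat m

/-- The domain `Ω = [-1/2, 1/2]^m`. -/
def Ω (m : ℕ) : Set (Fin m → ℝ) :=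
  Set.Icc (fun _ => -(1 / 2 : ℝ)) (fun _ => (1 / 2 : ℝ))

/-- Period one in every coordinate. -/
def IsPeriodic {m : ℕ} {β : Type*} (u : (Fin m → ℝ) → β) : Prop :=
  ∀ k : Fin m, Function.Periodic u (Pi.single k (1 : ℝ))

/-- The Frobenius inner product `⟨A, B⟩_F = tr(Aᵀ B)`. -/
def frobInner {m : ℕ} (A B : Mat m) : ℝ := (A.transpose * B).trace

/-- The nonlinearity `f(U) = U - U Uᵀ U`. -/
def f {m : ℕ} (A : Mat m) : Mat m := A - A * A.transpose * A

/-- The potential `F(U) = (1/4) (Uᵀ U - I)²`. -/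
def F {m : ℕ} (A : Mat m) : Mat m := (1 / 4 : ℝ) • (A.transpose * A - 1) ^ 2

/-- The stabilized nonlinearity `N = κ I + f`. -/
def N {m : ℕ} (κ : ℝ) (A : Mat m) : Mat m := κ • A + f A

/-- The set `X_m` of continuous periodic fields with values in the Frobenius ball of radius
`√m`. -/
structure InXm {m : ℕ} (U : Field m) : Prop where
  continuous : ∀ i j, Continuous fun x => U x i j
  periodic : IsPeriodic U
  norm_le : ∀ x, ‖U x‖ ≤ Real.sqrt m

/-- The heat semigroup `e^{tΔ}`, `t ≥ 0`, on continuous periodic fields: convolution with the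
heat kernel `(4πt)^{-m/2} exp(-|y|²/(4t)) dy`, that is, with the centred Gaussian whose
coordinates are independent of variance `2t` (the Dirac mass at the origin if `t = 0`). It acts
on each entry of the field. -/
def heat {m : ℕ} (t : ℝ) (W : Field m) : Field m := fun x =>
  Matrix.of fun i j => ∫ y, W (x - y) i j ∂(MeasureTheory.Measure.pi fun _ : Fin m =>
    ProbabilityTheory.gaussianReal 0 (2 * t).toNNReal)

/-- The semigroup `e^{-tL} = e^{-κt} e^{tε²Δ}` of `L = κ I - ε² Δ`. -/
def expNegL {m : ℕ} (ε κ t : ℝ) (W : Field m) : Field m := fun x =>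
  Real.exp (-(κ * t)) • heat (ε ^ 2 * t) W x

/-- The entrywise integral `∫₀^τ Φ(s) ds` of a family of fields. -/
def timeIntegral {m : ℕ} (τ : ℝ) (Φ : ℝ → Field m) : Field m := fun x =>
  Matrix.of fun i j => ∫ s in (0 : ℝ)..τ, Φ s x i j

/-- One step of the ETD1 scheme,
`e^{-τL} U + ∫₀^τ e^{-(τ-s)L} N[U] ds = e^{-τL} U + (I - e^{-τL}) L⁻¹ N[U]`. -/
def etd1Step {m : ℕ} (ε κ τ : ℝ) (U : Field m) : Field m :=
  expNegL ε κ τ U + timeIntegral τ fun s => expNegL ε κ (τ - s) fun y => N κ (U y)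

/-- One step of the ETDRK2 scheme, with `Ũ` the ETD1 step from `U`,
`e^{-τL} U + ∫₀^τ e^{-(τ-s)L} ((1 - s/τ) N[U] + (s/τ) N[Ũ]) ds`, which is
`Ũ - τ⁻¹ (e^{-τL} - I + τL) L⁻² (N[U] - N[Ũ])`. -/
def etdrk2Step {m : ℕ} (ε κ τ : ℝ) (U : Field m) : Field m :=
  expNegL ε κ τ U + timeIntegral τ fun s => expNegL ε κ (τ - s) fun y =>
    (1 - s / τ) • N κ (U y) + (s / τ) • N κ (etd1Step ε κ τ U y)

/-- The ETD1 iterates `U^n` started at `U^0 = U₀`. -/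
def etd1 {m : ℕ} (ε κ τ : ℝ) (U₀ : Field m) : ℕ → Field m
  | 0 => U₀
  | n + 1 => etd1Step ε κ τ (etd1 ε κ τ U₀ n)

/-- The ETDRK2 iterates `U^n` started at `U^0 = U₀`. -/
def etdrk2 {m : ℕ} (ε κ τ : ℝ) (U₀ : Field m) : ℕ → Field m
  | 0 => U₀
  | n + 1 => etdrk2Step ε κ τ (etdrk2 ε κ τ U₀ n)

/-- `G = (G₁, …, G_m)` is the weak gradient of the periodic field `U`: `G k` is the weak
derivative `∂_k U` (entry by entry), tested against smooth periodic functions. -/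
structure IsWeakGradient {m : ℕ} (U : Field m) (G : Fin m → Field m) : Prop where
  integrable : ∀ i j, MeasureTheory.IntegrableOn (fun x => U x i j) (Ω m)
  integrable_grad : ∀ k i j, MeasureTheory.IntegrableOn (fun x => G k x i j) (Ω m)
  integral_eq : ∀ (k i j : Fin m) (φ : (Fin m → ℝ) → ℝ), ContDiff ℝ ∞ φ →
    IsPeriodic φ →
    ∫ x in Ω m, fderiv ℝ φ x (Pi.single k 1) * U x i j = -∫ x in Ω m, φ x * G k x i j

/-- The energy `E(U) = ∫_Ω ((ε²/2) ‖∇U‖_F² + ⟨F(U), I⟩_F) dx`, where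
`‖∇U‖_F² = ∑_k ‖∂_k U‖_F²`. The integrand is nonnegative, since
`⟨F(U), I⟩_F = (1/4) ‖Uᵀ U - I‖_F²`, so `E` takes values in `[0, ∞]`. The weak gradient is
unique almost everywhere on `Ω`, so the infimum is the value at that gradient; it is `∞` if there
is no weak gradient, and also if the weak gradient is not square integrable. -/
def energy {m : ℕ} (ε : ℝ) (U : Field m) : ℝ≥0∞ :=
  ⨅ (G : Fin m → Field m) (_ : IsWeakGradient U G),
    ∫⁻ x in Ω m, ENNReal.ofReal
      (ε ^ 2 / 2 * ∑ k, ‖G k x‖ ^ 2 + frobInner (F (U x)) 1)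

end MatrixAllenCahn

end

noncomputable section

namespace MatrixAllenCahn

open MeasureTheory Set ProbabilityTheory
open scoped ComplexConjugate

/-! ### Algebra of the Frobenius inner product. -/

variable {m : ℕ}

/-! Write the energy as `½⟨LU, U⟩` plus the integral of `⟨F(U), I⟩ - (κ/2)‖U‖²`, where `L = κI -
ε²Δ`. The two parts are controlled by independent inequalities whose right-hand sides cancel.

Pointwise part. On the Frobenius ball of radius `√m`, an exact Taylor expansion of the quartic
potential bounds its second-order remainder by `((3m-1)/2)‖A - B‖²`. Since `κ ≥ 3m - 1`, the
function `⟨F(A), I⟩ - (κ/2)‖A‖²` lies below its tangents: its increment from `B` to `A` is at most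
`-⟨A - B, N(B)⟩` (`potential_sub_le_N`).

Spectral part. `L` is diagonal in the Fourier basis, so a step acts on each mode as a scalar
exponential integrator. An explicit sum of squares (`mode_dissipation`) bounds the growth of the
quadratic part by the work of the nonlinearity. For ETD1 this work is `⟨W - U, N[U]⟩`. For ETDRK2,
with predictor `W` and new value `V`, it is `⟨W - U, N[U]⟩ + ⟨V - W, N[W]⟩`, exactly what the
pointwise inequality yields when used from `U` to `W` and from `W` to `V`. Parseval sums the modes
(`duhamel_dissipation`), and `energy_le_of_dissipation` adds the two parts.

Two facts make this legitimate. All iterates and predictors stay in the ball: the heat semigroup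
averages, `‖N(A)‖ ≤ κ√m` on the ball (`norm_N_le`), and the weights of one step add up to one
(`norm_fieldDuhamel_le`). No regularity beyond continuity is known a priori: if `E(U)` is finite,
Parseval makes the spectral sum of `U` finite; the mode bounds carry this to the next iterate, and
Riesz–Fischer turns it back into a weak gradient. If `E(U) = ∞` there is nothing to prove. -/

theorem frobInner_eq_sum (A B : Mat m) : frobInner A B = ∑ i, ∑ j, A i j * B i j := by
  simp only [frobInner, Matrix.trace, Matrix.diag, Matrix.mul_apply, Matrix.transpose_apply]
  exact Finset.sum_comm

theorem norm_sq_eq_sum (A : Mat m) : ‖A‖ ^ 2 = ∑ i, ∑ j, A i j ^ 2 := by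
  rw [Matrix.frobenius_norm_def, ← Real.sqrt_eq_rpow, Real.sq_sqrt (by positivity)]
  simp

theorem norm_sq_eq_frobInner (A : Mat m) : ‖A‖ ^ 2 = frobInner A A := by
  rw [norm_sq_eq_sum, frobInner_eq_sum]
  simp only [sq]

theorem frobInner_le (A B : Mat m) : frobInner A B ≤ ‖A‖ * ‖B‖ := by
  refine abs_le_of_sq_le_sq' ?_ (by positivity) |>.2
  rw [mul_pow, norm_sq_eq_sum, norm_sq_eq_sum, frobInner_eq_sum]
  simp only [← Fintype.sum_prod_type']
  exact Finset.sum_mul_sq_le_sq_mul_sq _ _ _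

theorem frobInner_comm (A B : Mat m) : frobInner A B = frobInner B A := by
  simp only [frobInner_eq_sum, mul_comm]

theorem frobInner_add_left (A B C : Mat m) :
    frobInner (A + B) C = frobInner A C + frobInner B C := by
  simp [frobInner, add_mul]

theorem frobInner_sub_left (A B C : Mat m) :
    frobInner (A - B) C = frobInner A C - frobInner B C := by
  simp [frobInner, sub_mul]

theorem frobInner_smul_left (c : ℝ) (A B : Mat m) : frobInner (c • A) B = c * frobInner A B := by
  simp [frobInner]

theorem frobInner_add_right (A B C : Mat m) :
    frobInner A (B + C) = frobInner A B + frobInner A C := by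
  simp [frobInner, mul_add]

theorem frobInner_sub_right (A B C : Mat m) :
    frobInner A (B - C) = frobInner A B - frobInner A C := by
  simp [frobInner, mul_sub]

theorem frobInner_smul_right (c : ℝ) (A B : Mat m) : frobInner A (c • B) = c * frobInner A B := by
  simp [frobInner]

theorem norm_transpose_eq (A : Mat m) : ‖A.transpose‖ = ‖A‖ := by
  rw [← sq_eq_sq₀ (norm_nonneg _) (norm_nonneg _), norm_sq_eq_sum, norm_sq_eq_sum]
  exact Finset.sum_comm

theorem frobInner_one_one : frobInner (1 : Mat m) 1 = m := by
  simp [frobInner]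

/-! ### Pointwise bounds for the potential and the stabilized nonlinearity. -/

/-- `⟨F(A), I⟩ = ¼ ‖AᵀA - I‖²`. -/
theorem frobInner_F_one (A : Mat m) :
    frobInner (F A) 1 = 1 / 4 * ‖A.transpose * A - 1‖ ^ 2 := by
  rw [norm_sq_eq_frobInner, F, frobInner_smul_left]
  simp [frobInner, sq, Matrix.transpose_mul]

theorem norm_mul_sq_le {A B : Mat m} {r s : ℝ} (hA : ‖A‖ ^ 2 ≤ r) (hB : ‖B‖ ^ 2 ≤ s) :
    ‖A * B‖ ^ 2 ≤ r * s := by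
  calc ‖A * B‖ ^ 2 ≤ (‖A‖ * ‖B‖) ^ 2 := by gcongr; exact norm_mul_le A B
    _ = ‖A‖ ^ 2 * ‖B‖ ^ 2 := mul_pow _ _ _
    _ ≤ r * s := by gcongr; exact (sq_nonneg _).trans hA

theorem norm_sq_le_of_norm_le_sqrt {A : Mat m} (h : ‖A‖ ≤ Real.sqrt m) : ‖A‖ ^ 2 ≤ m :=
  (Real.le_sqrt (norm_nonneg _) (Nat.cast_nonneg _)).1 h

/-- With `V = A - B`, `S = BᵀB` and `T = AᵀA - BᵀB`, the potential difference is `½⟨S - I, T⟩ +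
¼‖T‖²`. The part of `⟨S - I, T⟩` linear in `V` is `-2⟨V, f(B)⟩`, which the added term cancels; only
the remainder is left, with no error. -/
theorem potential_taylor (A B : Mat m) :
    frobInner (F A - F B) 1 + frobInner (A - B) (f B) =
      1 / 4 * ‖A.transpose * A - B.transpose * B‖ ^ 2 +
        1 / 2 * ‖(A - B) * B.transpose‖ ^ 2 - 1 / 2 * ‖A - B‖ ^ 2 := by
  obtain ⟨V, rfl⟩ : ∃ V, A = B + V := ⟨A - B, by abel⟩
  rw [frobInner_sub_left, frobInner_F_one, frobInner_F_one]
  simp only [norm_sq_eq_frobInner, f, add_sub_cancel_left]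
  have h1 : (B + V).transpose * (B + V) =
      B.transpose * B + (B.transpose * V + V.transpose * B + V.transpose * V) := by
    rw [Matrix.transpose_add]; noncomm_ring
  set T := B.transpose * V + V.transpose * B + V.transpose * V with hT
  set S := B.transpose * B with hS
  rw [h1, add_sub_cancel_left, show S + T - 1 = (S - 1) + T by abel]
  have h2 : frobInner (S - 1) T = 2 * frobInner V (B * B.transpose * B - B) +
      (frobInner (V * B.transpose) (V * B.transpose) - frobInner V V) := by
    have e1 : (B.transpose * B * (B.transpose * V)).trace =
        (V.transpose * (B * B.transpose * B)).trace := by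
      rw [← Matrix.trace_transpose]
      simp [Matrix.transpose_mul, Matrix.mul_assoc]
    have e2 : (B.transpose * B * (V.transpose * B)).trace =
        (V.transpose * (B * B.transpose * B)).trace := by
      rw [Matrix.trace_mul_comm]; simp only [Matrix.mul_assoc]
    have e3 : (B.transpose * B * (V.transpose * V)).trace =
        (B * V.transpose * (V * B.transpose)).trace := by
      rw [Matrix.mul_assoc, Matrix.trace_mul_comm]; simp only [Matrix.mul_assoc]
    have e4 : (B.transpose * V).trace = (V.transpose * B).trace := by
      rw [← Matrix.trace_transpose]; simp
    simp only [hS, hT, frobInner_sub_left, frobInner_add_right, frobInner_sub_right]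
    simp only [frobInner, Matrix.transpose_mul, Matrix.transpose_transpose, Matrix.transpose_one,
      Matrix.one_mul, e1, e2, e3, e4]
    ring
  rw [frobInner_add_left, frobInner_add_right (S - 1) (S - 1), frobInner_add_right T (S - 1),
    frobInner_comm T (S - 1), h2,
    frobInner_sub_right V, frobInner_sub_right V]
  ring

/-- In the exact remainder, `‖AᵀA - BᵀB‖ ≤ 2√m‖A - B‖` and `‖(A - B)Bᵀ‖² ≤ m‖A - B‖²`, so the
coefficient is at most `m + m/2 - 1/2 = (3m-1)/2`. This is the origin of the threshold on `κ`. -/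
theorem potential_sub_le {κ : ℝ} (hκ : 3 * (m : ℝ) - 1 ≤ κ) {A B : Mat m}
    (hA : ‖A‖ ≤ Real.sqrt m) (hB : ‖B‖ ≤ Real.sqrt m) :
    frobInner (F A - F B) 1 + frobInner (A - B) (f B) ≤ κ / 2 * ‖A - B‖ ^ 2 := by
  rw [potential_taylor]
  have hm : (0 : ℝ) ≤ m := Nat.cast_nonneg m
  have h1 : ‖A.transpose * A - B.transpose * B‖ ≤ 2 * Real.sqrt m * ‖A - B‖ := by
    have : A.transpose * A - B.transpose * B =
        A.transpose * (A - B) + (A - B).transpose * B := by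
      rw [Matrix.transpose_sub]; noncomm_ring
    rw [this]
    calc _ ≤ ‖A.transpose * (A - B)‖ + ‖(A - B).transpose * B‖ := norm_add_le _ _
      _ ≤ ‖A.transpose‖ * ‖A - B‖ + ‖(A - B).transpose‖ * ‖B‖ :=
        add_le_add (norm_mul_le _ _) (norm_mul_le _ _)
      _ ≤ Real.sqrt m * ‖A - B‖ + ‖A - B‖ * Real.sqrt m := by
        rw [norm_transpose_eq, norm_transpose_eq]; gcongr
      _ = _ := by ring
  have h2 : ‖A.transpose * A - B.transpose * B‖ ^ 2 ≤ 4 * m * ‖A - B‖ ^ 2 := by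
    calc _ ≤ (2 * Real.sqrt m * ‖A - B‖) ^ 2 := by gcongr
      _ = _ := by rw [mul_pow, mul_pow, Real.sq_sqrt hm]; norm_num
  have h3 : ‖(A - B) * B.transpose‖ ^ 2 ≤ ‖A - B‖ ^ 2 * m :=
    norm_mul_sq_le le_rfl (by rw [norm_transpose_eq]; exact norm_sq_le_of_norm_le_sqrt hB)
  nlinarith [mul_nonneg (sub_nonneg.2 hκ) (sq_nonneg ‖A - B‖)]

/-- The ball is invariant under `κ⁻¹N`. Expand `‖κA - A(AᵀA - I)‖²` and bound the last square by
`m‖AᵀA - I‖²`; everything is then linear in `‖A‖²` and `‖AᵀA‖²`. -/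
theorem norm_N_le {κ : ℝ} (hm : 1 ≤ m) (hκ : 3 * (m : ℝ) - 1 ≤ κ) {A : Mat m}
    (hA : ‖A‖ ≤ Real.sqrt m) : ‖N κ A‖ ≤ κ * Real.sqrt m := by
  have hm' : (1 : ℝ) ≤ m := by exact_mod_cast hm
  have hκ0 : 0 ≤ κ := by linarith
  refine abs_le_of_sq_le_sq' ?_ (by positivity) |>.2
  rw [mul_pow, Real.sq_sqrt (by positivity)]
  have hA2 := norm_sq_le_of_norm_le_sqrt hA
  have h1 : ‖A * (A.transpose * A - 1)‖ ^ 2 ≤ m * ‖A.transpose * A - 1‖ ^ 2 :=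
    norm_mul_sq_le hA2 le_rfl
  have hD := sq_nonneg ‖A.transpose * A - 1‖
  have hN : N κ A = (κ + 1) • A - A * (A.transpose * A) := by
    rw [N, f, add_smul, one_smul, Matrix.mul_assoc]; abel
  rw [hN]
  rw [show A * (A.transpose * A - 1) = A * (A.transpose * A) - A by noncomm_ring] at h1
  rw [norm_sq_eq_frobInner] at h1 hA2 hD ⊢
  rw [norm_sq_eq_frobInner] at h1
  set S := A.transpose * A with hS
  have e1 : frobInner A (A * S) = frobInner S S := by
    simp [frobInner, hS, Matrix.transpose_mul, Matrix.mul_assoc]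
  have e2 : frobInner S 1 = frobInner A A := by
    simp [frobInner, hS, Matrix.transpose_mul]
  simp only [frobInner_sub_left, frobInner_sub_right, frobInner_smul_left, frobInner_smul_right,
    frobInner_comm (A * S) A, frobInner_comm 1 S, e1, e2, frobInner_one_one] at h1 hD ⊢
  set t₁ := frobInner A A
  set t₂ := frobInner S S
  set t₃ := frobInner (A * S) (A * S)
  -- With `D = ‖S - I‖²`, the bound `h1` gives `‖N(A)‖² ≤ κ²m - (2κ - m)D - κ(κ - 2)(m - t₁)`. Both
  -- subtracted terms are nonnegative because `κ ≥ 3m - 1` and `m ≥ 1`.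
  have k1 : 0 ≤ (2 * κ - m) * (t₂ - t₁ - (t₁ - m)) := mul_nonneg (by linarith) hD
  have k2 : 0 ≤ κ * (κ - 2) * (m - t₁) :=
    mul_nonneg (mul_nonneg hκ0 (by linarith)) (by linarith)
  nlinarith

/-- The pointwise energy inequality behind the unconditional stability. -/
theorem potential_sub_le_N {κ : ℝ} (hκ : 3 * (m : ℝ) - 1 ≤ κ) {A B : Mat m}
    (hA : ‖A‖ ≤ Real.sqrt m) (hB : ‖B‖ ≤ Real.sqrt m) :
    frobInner (F A) 1 - frobInner (F B) 1 ≤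
      κ / 2 * (‖A‖ ^ 2 - ‖B‖ ^ 2) - frobInner (A - B) (N κ B) := by
  have h := potential_sub_le hκ hA hB
  simp only [norm_sq_eq_frobInner, N, frobInner_sub_left, frobInner_sub_right, frobInner_add_right,
    frobInner_smul_right, frobInner_comm A B] at h ⊢
  linarith

/-! ### Scalar inequalities for a single Fourier mode. -/

/-- The propagator `e^{-λτ}` of a mode with eigenvalue `λ`. -/
def weight₀ (τ l : ℝ) : ℝ := Real.exp (-(l * τ))

/-- `∫₀^τ e^{-λ(τ-s)} ds`. -/
def weight₁ (τ l : ℝ) : ℝ := (1 - weight₀ τ l) / l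

/-- `∫₀^τ e^{-λ(τ-s)} s/τ ds`. -/
def weight₂ (τ l : ℝ) : ℝ := (weight₀ τ l - 1 + l * τ) / (τ * l ^ 2)

section modes

variable {τ l : ℝ}

theorem weight₀_pos : 0 < weight₀ τ l := Real.exp_pos _

theorem weight₀_lt_one (hτ : 0 < τ) (hl : 0 < l) : weight₀ τ l < 1 := by
  rw [weight₀, Real.exp_lt_one_iff]; nlinarith [mul_pos hl hτ]

theorem one_sub_lt_weight₀ (hτ : 0 < τ) (hl : 0 < l) : 1 - l * τ < weight₀ τ l := by
  have := Real.add_one_lt_exp (x := -(l * τ)) (by nlinarith [mul_pos hl hτ])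
  rw [weight₀]; linarith

/-- This is `1 + z ≤ e^z` at `z = lτ`, multiplied by `e^{-z}`. -/
theorem mul_weight₀_le :
    l * τ * weight₀ τ l ≤ 1 - weight₀ τ l := by
  have h := Real.add_one_le_exp (l * τ)
  have h2 : weight₀ τ l * Real.exp (l * τ) = 1 := by
    rw [weight₀, ← Real.exp_add]; simp
  nlinarith [weight₀_pos (τ := τ) (l := l)]

/-- The dissipation inequality of the ETDRK2 scheme for a single mode; the case `q = p` is the one
of the ETD1 scheme. -/
theorem mode_dissipation (hτ : 0 < τ) (hl : 0 < l) (u p q : ℝ) :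
    1 / 2 * (l * (weight₀ τ l * u + weight₁ τ l * p + weight₂ τ l * (q - p)) ^ 2) -
        1 / 2 * (l * u ^ 2) ≤
      (weight₀ τ l * u + weight₁ τ l * p - u) * p + weight₂ τ l * (q - p) * q := by
  have he0 := weight₀_pos (τ := τ) (l := l)
  have he1 := weight₀_lt_one hτ hl
  have he2 := one_sub_lt_weight₀ hτ hl
  have he3 := mul_weight₀_le (τ := τ) (l := l)
  have ha : weight₁ τ l = (1 - weight₀ τ l) / l := rfl
  have hb : weight₂ τ l = (weight₀ τ l - 1 + l * τ) / (τ * l ^ 2) := rfl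
  set e := weight₀ τ l
  have hz : 0 < l * τ := mul_pos hl hτ
  have d1 : 0 < 1 - e := by linarith
  have d2 : 0 < e - 1 + l * τ := by linarith
  set P := e * u + weight₁ τ l * p - u with hP
  set Q := weight₂ τ l * (q - p) with hQ
  -- The increments `P` (predictor) and `Q` (corrector) replace `p` and `q` as unknowns; `α` and `β`
  -- come from inverting the two weights.
  set α := 1 / (1 - e) with hα
  set β := l * τ / (e - 1 + l * τ) with hβ
  have hp : p = l * u + l * α * P := by
    rw [hP, hα, ha]; field_simp; ring
  have hq : q = p + l * β * Q := by
    rw [hQ, hβ, hb]; field_simp; ring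
  have hα1 : 1 ≤ α := by rw [hα, le_div_iff₀ d1]; linarith
  -- After clearing denominators, with `z = lτ`, this is `2ze ≤ z + (1 - e)`: the sum of `ze ≤ z`
  -- and `ze ≤ 1 - e`.
  have hαβ : α ≤ 2 * β := by
    rw [hα, hβ, ← mul_div_assoc, div_le_div_iff₀ d1 d2]
    nlinarith
  have hv : e * u + weight₁ τ l * p + Q = u + P + Q := by rw [hP]; ring
  rw [hv, hq, hp]
  -- Right side minus left side equals `l` times `(α-1)/2 (P+Q)² + α/2 P² + (β - α/2) Q²`.
  have k1 : 0 ≤ (α - 1) / 2 * (P + Q) ^ 2 := by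
    have : 0 ≤ α - 1 := by linarith
    positivity
  have k2 : 0 ≤ α / 2 * P ^ 2 := by positivity
  have k3 : 0 ≤ (β - α / 2) * Q ^ 2 := mul_nonneg (by linarith) (sq_nonneg _)
  nlinarith [mul_nonneg hl.le (add_nonneg k1 (add_nonneg k2 k3))]

theorem mode_dissipation_complex (hτ : 0 < τ) (hl : 0 < l) (u p q : ℂ) :
    1 / 2 * (l * ‖weight₀ τ l * u + weight₁ τ l * p + weight₂ τ l * (q - p)‖ ^ 2) -
        1 / 2 * (l * ‖u‖ ^ 2) ≤
      ((starRingEnd ℂ) (weight₀ τ l * u + weight₁ τ l * p - u) * p).re +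
        ((starRingEnd ℂ) (weight₂ τ l * (q - p)) * q).re := by
  have h1 := mode_dissipation hτ hl u.re p.re q.re
  have h2 := mode_dissipation hτ hl u.im p.im q.im
  simp only [Complex.sq_norm, Complex.normSq_apply, Complex.mul_re, Complex.add_re,
    Complex.sub_re, Complex.mul_im, Complex.add_im, Complex.sub_im, Complex.conj_re,
    Complex.conj_im, Complex.ofReal_re, Complex.ofReal_im, zero_mul, sub_zero, add_zero]
  linarith

/-- Both `weight₁` and `weight₂` are at most `1/l`, which absorbs the factor `l`. Hence square
summability of the coefficients of `p` and `q` suffices, and the weighted norm is needed only for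
`u`. -/
theorem mode_bound (hτ : 0 < τ) (hl : 0 < l) (u p q : ℂ) :
    l * ‖weight₀ τ l * u + weight₁ τ l * p + weight₂ τ l * (q - p)‖ ^ 2 ≤
      3 * (l * ‖u‖ ^ 2) + 12 / l * (‖p‖ ^ 2 + ‖q‖ ^ 2) := by
  have he0 := weight₀_pos (τ := τ) (l := l)
  have he1 := weight₀_lt_one hτ hl
  have he2 := one_sub_lt_weight₀ hτ hl
  have a0 : 0 ≤ weight₁ τ l := div_nonneg (by linarith) hl.le
  have a1 : weight₁ τ l ≤ 1 / l := by
    rw [weight₁]; gcongr; linarith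
  have b0 : 0 ≤ weight₂ τ l := div_nonneg (by linarith) (by positivity)
  have b1 : weight₂ τ l ≤ 1 / l := by
    rw [weight₂, div_le_div_iff₀ (by positivity) hl]; nlinarith [mul_pos hl hl]
  have n1 : ‖weight₀ τ l * u + weight₁ τ l * p + weight₂ τ l * (q - p)‖ ≤
      ‖u‖ + 1 / l * ‖p‖ + 1 / l * (‖q‖ + ‖p‖) := by
    refine (norm_add₃_le).trans ?_
    simp only [norm_mul, Complex.norm_real, Real.norm_eq_abs, abs_of_nonneg he0.le,
      abs_of_nonneg a0, abs_of_nonneg b0]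
    gcongr
    · nlinarith [norm_nonneg u]
    · exact norm_sub_le _ _
  calc _ ≤ l * (‖u‖ + 1 / l * ‖p‖ + 1 / l * (‖q‖ + ‖p‖)) ^ 2 := by gcongr
    _ ≤ l * (3 * (‖u‖ ^ 2 + (2 * (1 / l * ‖p‖)) ^ 2 + (1 / l * ‖q‖) ^ 2)) := by
      gcongr
      nlinarith [sq_nonneg (‖u‖ - 2 * (1 / l * ‖p‖)), sq_nonneg (‖u‖ - 1 / l * ‖q‖),
        sq_nonneg (2 * (1 / l * ‖p‖) - 1 / l * ‖q‖)]
    _ = 3 * (l * ‖u‖ ^ 2) + 12 / l * ‖p‖ ^ 2 + 3 / l * ‖q‖ ^ 2 := by field_simp; ring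
    _ ≤ _ := by
      rw [mul_add, ← add_assoc]; gcongr; norm_num

end modes

/-! ### Periodic functions, the torus and Fourier series. -/

section torus

attribute [local instance] instMeasureSpaceUnitAddCircle instIsAddHaarMeasureUnitAddCircleVolume
  instIsProbabilityMeasureUnitAddCircleVolume

/-- The projection `ℝ^m → (ℝ/ℤ)^m`. -/
def torusMk (x : Fin m → ℝ) : UnitAddTorus (Fin m) := fun i => (x i : UnitAddCircle)

/-- The representative in `(-1/2, 1/2]^m` of a point of the torus. -/
def torusLift (t : UnitAddTorus (Fin m)) : Fin m → ℝ :=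
  fun i => (AddCircle.equivIoc (1 : ℝ) (-(1 / 2)) (t i)).1

theorem torusMk_torusLift (t : UnitAddTorus (Fin m)) : torusMk (torusLift t) = t := by
  funext i
  exact (AddCircle.equivIoc (1 : ℝ) (-(1 / 2))).symm_apply_apply (t i)

theorem torusLift_mem (t : UnitAddTorus (Fin m)) (i : Fin m) :
    torusLift t i ∈ Ioc (-(1 / 2) : ℝ) (-(1 / 2) + 1) :=
  (AddCircle.equivIoc (1 : ℝ) (-(1 / 2)) (t i)).2

theorem torusLift_mem_Ω (t : UnitAddTorus (Fin m)) : torusLift t ∈ Ω m :=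
  ⟨fun i => (torusLift_mem t i).1.le, fun i => (torusLift_mem t i).2.trans (by norm_num)⟩

theorem torusLift_torusMk {x : Fin m → ℝ}
    (hx : ∀ i, x i ∈ Ioc (-(1 / 2) : ℝ) (-(1 / 2) + 1)) : torusLift (torusMk x) = x := by
  funext i
  exact congrArg Subtype.val
    ((AddCircle.equivIoc (1 : ℝ) (-(1 / 2))).apply_symm_apply ⟨x i, hx i⟩)

theorem isCompact_Ω : IsCompact (Ω m) := isCompact_Icc

theorem measurableSet_Ω : MeasurableSet (Ω m) := measurableSet_Icc

theorem ae_restrict_Ω_mem :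
    ∀ᵐ x ∂volume.restrict (Ω m), ∀ i, x i ∈ Ioc (-(1 / 2) : ℝ) (-(1 / 2) + 1) := by
  have h : (univ.pi fun _ : Fin m => Ioc (-(1 / 2) : ℝ) (1 / 2)) =ᵐ[volume] Ω m :=
    Measure.univ_pi_Ioc_ae_eq_Icc
  rw [← Measure.restrict_congr_set h]
  filter_upwards [ae_restrict_mem (MeasurableSet.univ_pi fun i => measurableSet_Ioc)] with x hx i
  have := hx i (mem_univ i)
  norm_num at this ⊢
  exact this

theorem measurePreserving_torusMk :
    MeasurePreserving (torusMk (m := m)) (volume.restrict (Ω m)) volume := by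
  have h : (univ.pi fun _ : Fin m => Ioc (-(1 / 2) : ℝ) (-(1 / 2) + 1)) =ᵐ[volume] Ω m := by
    have := Measure.univ_pi_Ioc_ae_eq_Icc (μ := fun _ : Fin m => (volume : Measure ℝ))
      (f := fun _ => -(1 / 2)) (g := fun _ => 1 / 2)
    norm_num at this ⊢
    exact this
  rw [← Measure.restrict_congr_set h, volume_pi, volume_pi, Measure.restrict_pi_pi]
  refine measurePreserving_pi _ _ fun i => ?_
  have := AddCircle.measurePreserving_mk 1 (-(1 / 2))
  rwa [AddCircle.volume_eq_smul_haarAddCircle, ENNReal.ofReal_one, one_smul] at this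

theorem measurePreserving_torusLift :
    MeasurePreserving (torusLift (m := m)) volume (volume.restrict (Ω m)) := by
  have hm : Measurable (torusLift (m := m)) :=
    measurable_pi_lambda _ fun i => measurable_subtype_coe.comp
      ((AddCircle.measurableEquivIoc 1 (-(1 / 2))).measurable.comp (measurable_pi_apply i))
  refine ⟨hm, ?_⟩
  rw [← measurePreserving_torusMk.map_eq, Measure.map_map hm measurePreserving_torusMk.measurable]
  conv_rhs => rw [← Measure.map_id (μ := volume.restrict (Ω m))]
  refine Measure.map_congr ?_
  filter_upwards [ae_restrict_Ω_mem] with x hx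
  exact torusLift_torusMk hx

/-- No measurability of `u` is required, since `torusLift` is a measurable embedding. -/
theorem integral_torus_comp {E : Type*} [NormedAddCommGroup E] [NormedSpace ℝ E]
    (u : (Fin m → ℝ) → E) : ∫ t, u (torusLift t) = ∫ x in Ω m, u x := by
  refine measurePreserving_torusLift.integral_comp ?_ u
  have h : MeasurableSet {x : Fin m → ℝ | ∀ i, x i ∈ Ioc (-(1 / 2) : ℝ) (-(1 / 2) + 1)} :=
    MeasurableSet.univ_pi' fun i => measurableSet_Ioc
  exact (MeasurableEmbedding.subtype_coe h).comp
    (UnitAddTorus.measurableEquivPiIoc fun _ : Fin m => (-(1 / 2) : ℝ)).measurableEmbedding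

section periodic

variable {β : Type*} {u : (Fin m → ℝ) → β}

theorem IsPeriodic.add_intVec (hu : IsPeriodic u) (x : Fin m → ℝ) (n : Fin m → ℤ) :
    u (x + fun i => (n i : ℝ)) = u x := by
  have h : ∀ s : Finset (Fin m), ∀ x, u (x + ∑ k ∈ s, n k • Pi.single k (1 : ℝ)) = u x := by
    intro s
    induction s using Finset.induction_on with
    | empty => simp
    | insert k s hk ih =>
      intro x
      rw [Finset.sum_insert hk, ← add_assoc, add_right_comm]
      exact ((hu k).zsmul (n k) _).trans (ih x)
  have h2 := h Finset.univ x
  rwa [show (∑ k, n k • (Pi.single k (1 : ℝ) : Fin m → ℝ)) = fun i => (n i : ℝ) by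
    funext i; simp [Finset.sum_apply, Pi.single_apply]] at h2

theorem IsPeriodic.torusLift_torusMk (hu : IsPeriodic u) (x : Fin m → ℝ) :
    u (torusLift (torusMk x)) = u x := by
  have h : ∀ i, ∃ k : ℤ, torusLift (torusMk x) i = x i + k := by
    intro i
    have h1 := congrFun (torusMk_torusLift (torusMk x)) i
    have h2 : ((torusLift (torusMk x) i - x i : ℝ) : UnitAddCircle) = 0 := by
      rw [AddCircle.coe_sub, sub_eq_zero]; exact h1
    obtain ⟨k, hk⟩ := (AddCircle.coe_eq_zero_iff 1).1 h2
    exact ⟨k, by rw [zsmul_eq_mul, mul_one] at hk; linarith⟩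
  choose k hk using h
  rw [show torusLift (torusMk x) = x + fun i => (k i : ℝ) from funext hk]
  exact hu.add_intVec x k

theorem torusMk_add (x y : Fin m → ℝ) : torusMk (x + y) = torusMk x + torusMk y := by
  funext i; simp [torusMk]

theorem IsPeriodic.comp {γ : Type*} (hu : IsPeriodic u) (g : β → γ) :
    IsPeriodic fun x => g (u x) := fun k x => congrArg g (hu k x)

theorem IsPeriodic.integral_comp_add {E : Type*} [NormedAddCommGroup E] [NormedSpace ℝ E]
    {u : (Fin m → ℝ) → E} (hu : IsPeriodic u) (y : Fin m → ℝ) :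
    ∫ x in Ω m, u (x + y) = ∫ x in Ω m, u x := by
  rw [← integral_torus_comp, ← integral_torus_comp u,
    ← integral_add_right_eq_self (fun t : UnitAddTorus (Fin m) => u (torusLift t)) (torusMk y)]
  congr 1
  funext t
  rw [← hu.torusLift_torusMk, torusMk_add, torusMk_torusLift]

theorem IsPeriodic.exists_norm_le {E : Type*} [NormedAddCommGroup E]
    {u : (Fin m → ℝ) → E} (hu : IsPeriodic u) (hc : Continuous u) : ∃ C, ∀ x, ‖u x‖ ≤ C := by
  obtain ⟨C, hC⟩ := isCompact_Ω.exists_bound_of_continuousOn hc.continuousOn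
  exact ⟨C, fun x => hu.torusLift_torusMk x ▸ hC _ (torusLift_mem_Ω _)⟩

end periodic

instance : IsFiniteMeasure (volume.restrict (Ω m)) :=
  ⟨by simpa using isCompact_Ω.measure_lt_top⟩

/-- The exponential `x ↦ e^{2πi n·x}`. -/
def wave (n : Fin m → ℤ) (x : Fin m → ℝ) : ℂ := UnitAddTorus.mFourier n (torusMk x)

section wave

variable (n : Fin m → ℤ)

theorem wave_eq_prod (x : Fin m → ℝ) :
    wave n x = ∏ i, Complex.exp (2 * Real.pi * n i * x i * Complex.I) := by
  simp only [wave, UnitAddTorus.mFourier, ContinuousMap.coe_mk, torusMk, fourier_coe_apply]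
  refine Finset.prod_congr rfl fun i _ => ?_
  congr 1
  push_cast
  ring

theorem wave_eq_exp (x : Fin m → ℝ) :
    wave n x = Complex.exp (∑ i, 2 * Real.pi * n i * x i * Complex.I) := by
  rw [wave_eq_prod, Complex.exp_sum]

theorem wave_add (x y : Fin m → ℝ) : wave n (x + y) = wave n x * wave n y := by
  rw [wave_eq_exp, wave_eq_exp, wave_eq_exp, ← Complex.exp_add, ← Finset.sum_add_distrib]
  congr 1
  refine Finset.sum_congr rfl fun i _ => ?_
  simp only [Pi.add_apply, Complex.ofReal_add]
  ring

theorem wave_neg (x : Fin m → ℝ) : wave n (-x) = conj (wave n x) := by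
  rw [wave, wave, ← UnitAddTorus.mFourier_neg]
  simp only [UnitAddTorus.mFourier, ContinuousMap.coe_mk, torusMk, Pi.neg_apply, AddCircle.coe_neg]
  simp [fourier_apply]

theorem norm_wave (x : Fin m → ℝ) : ‖wave n x‖ = 1 := by
  rw [wave_eq_prod, norm_prod]
  refine Finset.prod_eq_one fun i _ => ?_
  have := Complex.norm_exp_ofReal_mul_I (2 * Real.pi * n i * x i)
  push_cast at this
  exact this

theorem contDiff_wave : ContDiff ℝ ∞ (wave n) := by
  rw [show wave n = fun x => Complex.exp (∑ i, 2 * Real.pi * n i * x i * Complex.I) from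
    funext (wave_eq_exp n)]
  refine ContDiff.cexp (ContDiff.sum fun i _ => ?_)
  exact (contDiff_const.mul (Complex.ofRealCLM.contDiff.comp (contDiff_apply ℝ ℝ i))).mul
    contDiff_const

theorem continuous_wave : Continuous (wave n) := (contDiff_wave n).continuous

theorem isPeriodic_wave : IsPeriodic (wave n) := fun k x => by
  rw [wave_add]
  have : wave n (Pi.single k 1) = 1 := by
    rw [wave_eq_prod]
    refine Finset.prod_eq_one fun i _ => ?_
    rcases eq_or_ne i k with rfl | h
    · have := Complex.exp_int_mul_two_pi_mul_I (n i)
      rw [Pi.single_eq_same, ← this]; congr 1; push_cast; ring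
    · simp [h]
  rw [this, mul_one]

-- Differentiate along the line `x + s e_k`, where `wave_add` reduces the wave to a one-variable
-- exponential.
theorem fderiv_wave (x : Fin m → ℝ) (k : Fin m) :
    fderiv ℝ (wave n) x (Pi.single k 1) = 2 * Real.pi * n k * Complex.I * wave n x := by
  have h1 : HasDerivAt (fun s : ℝ => wave n (x + s • Pi.single k 1))
      (fderiv ℝ (wave n) x (Pi.single k 1)) 0 := by
    have hd : HasFDerivAt (wave n) (fderiv ℝ (wave n) x)
        (x + (0 : ℝ) • (Pi.single k 1 : Fin m → ℝ)) := by
      simpa using ((contDiff_wave n).differentiable (by simp) x).hasFDerivAt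
    have hl : HasDerivAt (fun s : ℝ => x + s • (Pi.single k 1 : Fin m → ℝ))
        (Pi.single k 1) 0 := by
      simpa using ((hasDerivAt_id (0 : ℝ)).smul_const (Pi.single k 1 : Fin m → ℝ)).const_add x
    exact hd.comp_hasDerivAt 0 hl
  have h2 : HasDerivAt (fun s : ℝ => wave n (x + s • Pi.single k 1))
      (2 * Real.pi * n k * Complex.I * wave n x) 0 := by
    have h3 : (fun s : ℝ => wave n (x + s • Pi.single k 1)) =
        fun s : ℝ => wave n x * Complex.exp ((2 * Real.pi * n k * Complex.I) * s) := by
      funext s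
      rw [wave_add, wave_eq_exp n (s • _)]
      congr 2
      rw [Finset.sum_eq_single k]
      · simp; ring
      · intro i _ hi; simp [hi]
      · simp
    rw [h3]
    have h4 : HasDerivAt (fun s : ℝ => (2 * Real.pi * n k * Complex.I) * (s : ℂ))
        (2 * Real.pi * n k * Complex.I) 0 := by
      simpa using (Complex.ofRealCLM.hasDerivAt (x := (0 : ℝ))).const_mul
        (2 * Real.pi * n k * Complex.I)
    simpa [mul_comm] using (h4.cexp).const_mul (wave n x)
  exact h1.unique h2

end wave

/-- The Fourier coefficients on `Ω`. -/
def fourierCoef (u : (Fin m → ℝ) → ℂ) (n : Fin m → ℤ) : ℂ := ∫ x in Ω m, conj (wave n x) * u x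

theorem mFourierCoeff_comp_torusLift (u : (Fin m → ℝ) → ℂ) (n : Fin m → ℤ) :
    UnitAddTorus.mFourierCoeff (fun t => u (torusLift t)) n = fourierCoef u n := by
  rw [fourierCoef, ← integral_torus_comp, UnitAddTorus.mFourierCoeff]
  congr 1
  funext t
  rw [wave, torusMk_torusLift, UnitAddTorus.mFourier_neg, smul_eq_mul]

theorem mFourierCoeff_congr_ae {u v : UnitAddTorus (Fin m) → ℂ} (h : u =ᵐ[volume] v)
    (n : Fin m → ℤ) : UnitAddTorus.mFourierCoeff u n = UnitAddTorus.mFourierCoeff v n :=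
  integral_congr_ae (h.mono fun t ht => by simp only [ht])

/-- Parseval's identity on `Ω`. -/
theorem hasSum_fourierCoef_mul {u v : (Fin m → ℝ) → ℂ} (hu : MemLp u 2 (volume.restrict (Ω m)))
    (hv : MemLp v 2 (volume.restrict (Ω m))) :
    HasSum (fun n => conj (fourierCoef u n) * fourierCoef v n) (∫ x in Ω m, conj (u x) * v x) := by
  have hu' := hu.comp_measurePreserving measurePreserving_torusLift
  have hv' := hv.comp_measurePreserving measurePreserving_torusLift
  have hcu : ∀ n, UnitAddTorus.mFourierCoeff (hu'.toLp _) n = fourierCoef u n := fun n =>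
    (mFourierCoeff_congr_ae hu'.coeFn_toLp n).trans (mFourierCoeff_comp_torusLift u n)
  have hcv : ∀ n, UnitAddTorus.mFourierCoeff (hv'.toLp _) n = fourierCoef v n := fun n =>
    (mFourierCoeff_congr_ae hv'.coeFn_toLp n).trans (mFourierCoeff_comp_torusLift v n)
  have h := UnitAddTorus.hasSum_prod_mFourierCoeff (hu'.toLp _) (hv'.toLp _)
  have he : ∫ t, conj (hu'.toLp _ t) * hv'.toLp _ t = ∫ x in Ω m, conj (u x) * v x := by
    rw [← integral_torus_comp]
    refine integral_congr_ae ?_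
    filter_upwards [hu'.coeFn_toLp, hv'.coeFn_toLp] with t h1 h2
    rw [h1, h2]
    rfl
  rw [he] at h
  simpa only [hcu, hcv] using h

theorem hasSum_norm_fourierCoef_sq {u : (Fin m → ℝ) → ℂ}
    (hu : MemLp u 2 (volume.restrict (Ω m))) :
    HasSum (fun n => ‖fourierCoef u n‖ ^ 2) (∫ x in Ω m, ‖u x‖ ^ 2) := by
  have h := hasSum_fourierCoef_mul hu hu
  simp only [Complex.conj_mul', ← Complex.ofReal_pow, integral_complex_ofReal] at h
  exact_mod_cast h

/-- The Riesz–Fischer theorem on `Ω`. -/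
theorem exists_fourierCoef_eq {c : (Fin m → ℤ) → ℂ} (hc : Summable fun n => ‖c n‖ ^ 2) :
    ∃ g : (Fin m → ℝ) → ℂ, MemLp g 2 (volume.restrict (Ω m)) ∧ ∀ n, fourierCoef g n = c n := by
  have hc' : Memℓp c 2 := memℓp_gen (by simpa using hc)
  set G := UnitAddTorus.mFourierBasis.repr.symm ⟨c, hc'⟩ with hG
  refine ⟨fun x => G (torusMk x),
    (Lp.memLp G).comp_measurePreserving measurePreserving_torusMk, fun n => ?_⟩
  rw [← mFourierCoeff_comp_torusLift]
  simp only [torusMk_torusLift]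
  rw [← UnitAddTorus.mFourierBasis_repr, hG, LinearIsometryEquiv.apply_symm_apply]

theorem fderiv_periodic {E : Type*} [NormedAddCommGroup E] [NormedSpace ℝ E]
    {u : (Fin m → ℝ) → E} (hu : IsPeriodic u) : IsPeriodic (fderiv ℝ u) := fun k x => by
  rw [← fderiv_comp_add_right]
  congr 1
  exact funext fun y => hu k y

/-- The integral of a derivative of a periodic function vanishes. -/
theorem integral_fderiv_eq_zero {E : Type*} [NormedAddCommGroup E] [NormedSpace ℝ E]
    [CompleteSpace E] {u : (Fin m → ℝ) → E} (hu : IsPeriodic u) (hc : ContDiff ℝ 1 u)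
    (v : Fin m → ℝ) : ∫ x in Ω m, fderiv ℝ u x v = 0 := by
  have hd : Continuous fun x => fderiv ℝ u x v :=
    (hc.continuous_fderiv one_ne_zero).clm_apply continuous_const
  have hp : IsPeriodic fun x => fderiv ℝ u x v := (fderiv_periodic hu).comp fun L => L v
  -- Integrated over `Ω`, the left side vanishes by translation invariance; after Fubini, the same
  -- invariance makes the inner integral independent of `s`.
  have h1 : ∀ x, u (x + v) - u x = ∫ s in (0 : ℝ)..1, fderiv ℝ u (x + s • v) v := by
    intro x
    have := intervalIntegral.integral_eq_sub_of_hasDerivAt (a := 0) (b := 1)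
      (f := fun s : ℝ => u (x + s • v)) (f' := fun s => fderiv ℝ u (x + s • v) v)
      (fun s _ => ?_) ?_
    · simpa using this.symm
    · exact ((hc.differentiable one_ne_zero _).hasFDerivAt).comp_hasDerivAt s
        (by simpa using ((hasDerivAt_id s).smul_const v).const_add x)
    · exact (hd.comp (by fun_prop)).intervalIntegrable _ _
  have h2 : ∫ x in Ω m, (u (x + v) - u x) = 0 := by
    have hi : ∀ w : (Fin m → ℝ) → E, Continuous w → IntegrableOn w (Ω m) :=
      fun w hw => hw.continuousOn.integrableOn_compact isCompact_Ω
    rw [integral_sub (f := fun x => u (x + v)) (hi _ (hc.continuous.comp (continuous_add_const v)))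
      (hi _ hc.continuous),
      hu.integral_comp_add, sub_self]
  simp only [h1] at h2
  rw [← h2]
  simp only [intervalIntegral.integral_of_le zero_le_one]
  rw [integral_integral_swap]
  · simp only [hp.integral_comp_add]
    simp
  · obtain ⟨C, hC⟩ := hp.exists_norm_le hd
    refine Integrable.of_bound (C := C) ?_ (.of_forall fun z => hC _)
    exact (hd.comp (by fun_prop)).aestronglyMeasurable

end torus

/-! ### The heat semigroup on scalar functions. -/

/-- Continuous periodic real functions. -/
structure ContPeriodic (u : (Fin m → ℝ) → ℝ) : Prop where
  continuous : Continuous u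
  periodic : IsPeriodic u

/-- The law of a centred Gaussian vector with independent coordinates of variance `2t`. -/
abbrev heatMeasure (m : ℕ) (t : ℝ) : Measure (Fin m → ℝ) :=
  Measure.pi fun _ : Fin m => gaussianReal 0 (2 * t).toNNReal

/-- The heat semigroup on scalar functions. -/
def scalarHeat (t : ℝ) (u : (Fin m → ℝ) → ℝ) (x : Fin m → ℝ) : ℝ :=
  ∫ y, u (x - y) ∂heatMeasure m t

theorem heat_apply (t : ℝ) (W : Field m) (x : Fin m → ℝ) (i j : Fin m) :
    heat t W x i j = scalarHeat t (fun y => W y i j) x := rfl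

/-- Rescaling one fixed Gaussian moves `t` into the integrand, so dominated convergence gives joint
continuity in time and space. For `t < 0` both sides are the Dirac mass, since `Real.sqrt` and
`Real.toNNReal` vanish there; continuity thus holds for all real `t`. -/
theorem heatMeasure_eq_map (t : ℝ) :
    heatMeasure m t = (Measure.pi fun _ : Fin m => gaussianReal 0 1).map
      fun z => Real.sqrt (2 * t) • z := by
  have h : gaussianReal 0 (2 * t).toNNReal = (gaussianReal 0 1).map (Real.sqrt (2 * t) * ·) := by
    rw [gaussianReal_map_const_mul, mul_zero, mul_one]
    congr 1
    apply NNReal.eq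
    rw [Real.coe_toNNReal']
    exact Real.sq_sqrt'.symm
  rw [heatMeasure]
  simp only [h]
  have : ∀ i : Fin m, SigmaFinite ((gaussianReal 0 1).map (Real.sqrt (2 * t) * ·)) := fun _ => by
    rw [← h]; infer_instance
  rw [← Measure.pi_map_pi (μ := fun _ : Fin m => gaussianReal 0 1)
    (f := fun _ x => Real.sqrt (2 * t) * x) (fun _ => by fun_prop)]
  rfl

theorem scalarHeat_eq_integral_std {u : (Fin m → ℝ) → ℝ} (hu : Continuous u) (t : ℝ)
    (x : Fin m → ℝ) : scalarHeat t u x =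
      ∫ z, u (x - Real.sqrt (2 * t) • z) ∂Measure.pi fun _ : Fin m => gaussianReal 0 1 := by
  rw [scalarHeat, heatMeasure_eq_map, integral_map (by fun_prop)]
  exact (hu.comp (by fun_prop)).aestronglyMeasurable

namespace ContPeriodic

variable {u v : (Fin m → ℝ) → ℝ}

theorem exists_norm_le (hu : ContPeriodic u) : ∃ C, ∀ x, ‖u x‖ ≤ C :=
  hu.periodic.exists_norm_le hu.continuous

theorem continuous_scalarHeat (hu : ContPeriodic u) :
    Continuous fun z : ℝ × (Fin m → ℝ) => scalarHeat z.1 u z.2 := by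
  obtain ⟨C, hC⟩ := hu.exists_norm_le
  simp only [scalarHeat_eq_integral_std hu.continuous]
  refine continuous_of_dominated (bound := fun _ => C) (fun z => ?_)
    (fun z => .of_forall fun _ => hC _) (integrable_const C) (.of_forall fun y => ?_)
  · exact (hu.continuous.comp (by fun_prop)).aestronglyMeasurable
  · exact hu.continuous.comp (by fun_prop)

theorem scalarHeat (hu : ContPeriodic u) (t : ℝ) : ContPeriodic (scalarHeat t u) where
  continuous := hu.continuous_scalarHeat.comp (by fun_prop : Continuous fun x => (t, x))
  periodic := fun k x => by
    simp only [MatrixAllenCahn.scalarHeat, add_sub_right_comm, hu.periodic k _]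

theorem integrable_comp_sub (hu : ContPeriodic u) (μ : Measure (Fin m → ℝ)) [IsFiniteMeasure μ]
    (x : Fin m → ℝ) : Integrable (fun y => u (x - y)) μ := by
  obtain ⟨C, hC⟩ := hu.exists_norm_le
  exact .of_bound (hu.continuous.comp (by fun_prop)).aestronglyMeasurable C (.of_forall fun y => hC _)

theorem scalarHeat_lin (hu : ContPeriodic u) (hv : ContPeriodic v) (t a b : ℝ) (x : Fin m → ℝ) :
    MatrixAllenCahn.scalarHeat t (fun y => a * u y + b * v y) x =
      a * MatrixAllenCahn.scalarHeat t u x + b * MatrixAllenCahn.scalarHeat t v x := by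
  simp only [MatrixAllenCahn.scalarHeat]
  rw [integral_add ((hu.integrable_comp_sub _ x).const_mul a)
    ((hv.integrable_comp_sub _ x).const_mul b), integral_const_mul, integral_const_mul]

end ContPeriodic

/-- The eigenvalue `4π²|n|²` of `-Δ`. -/
def freqSq (n : Fin m → ℤ) : ℝ := ∑ k, (2 * Real.pi * n k) ^ 2

theorem freqSq_nonneg (n : Fin m → ℤ) : 0 ≤ freqSq n := by
  unfold freqSq; positivity

/-- A product of one-dimensional Gaussian characteristic functions: variance `2t` at frequency
`2πnᵢ` gives `exp(-(2πnᵢ)²t)`. -/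
theorem integral_conj_wave_heatMeasure {t : ℝ} (ht : 0 ≤ t) (n : Fin m → ℤ) :
    ∫ y, conj (wave n y) ∂heatMeasure m t = Real.exp (-(freqSq n * t)) := by
  have h1 : ∀ y : Fin m → ℝ, conj (wave n y) =
      ∏ i, Complex.exp ((-(2 * Real.pi * n i) : ℝ) * y i * Complex.I) := by
    intro y
    rw [wave_eq_prod, map_prod]
    refine Finset.prod_congr rfl fun i _ => ?_
    rw [← Complex.exp_conj]
    congr 1
    simp only [map_mul, Complex.conj_I, Complex.conj_ofReal, map_ofNat, map_intCast]
    push_cast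
    ring
  simp only [h1]
  rw [integral_fintype_prod_eq_prod
    (f := fun i (y : ℝ) => Complex.exp ((-(2 * Real.pi * n i) : ℝ) * y * Complex.I))]
  simp only [← charFun_apply_real, charFun_gaussianReal]
  rw [← Complex.exp_sum, Complex.ofReal_exp]
  congr 1
  rw [freqSq, Finset.sum_mul, ← Finset.sum_neg_distrib]
  push_cast
  refine Finset.sum_congr rfl fun i _ => ?_
  rw [Real.coe_toNNReal _ (by positivity)]
  push_cast
  ring

/-- The Fourier coefficients of a real function. -/
abbrev realCoef (u : (Fin m → ℝ) → ℝ) (n : Fin m → ℤ) : ℂ := fourierCoef (fun x => (u x : ℂ)) n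

/-- Fubini and a translation factor the coefficient of a convolution, leaving the characteristic
function of the heat kernel. -/
theorem realCoef_scalarHeat {u : (Fin m → ℝ) → ℝ} (hu : ContPeriodic u) {t : ℝ} (ht : 0 ≤ t)
    (n : Fin m → ℤ) :
    realCoef (scalarHeat t u) n = Real.exp (-(freqSq n * t)) * realCoef u n := by
  obtain ⟨C, hC⟩ := hu.exists_norm_le
  have hper : IsPeriodic fun x => conj (wave n x) * (u x : ℂ) := fun k x => by
    simp only [isPeriodic_wave n k x, hu.periodic k x]
  calc realCoef (scalarHeat t u) n
      = ∫ x in Ω m, ∫ y, conj (wave n x) * (u (x - y) : ℂ) ∂heatMeasure m t := by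
        rw [realCoef, fourierCoef]
        congr 1
        funext x
        rw [integral_const_mul, scalarHeat, integral_complex_ofReal]
    _ = ∫ y, (∫ x in Ω m, conj (wave n x) * (u (x - y) : ℂ)) ∂heatMeasure m t := by
        refine integral_integral_swap ?_
        refine Integrable.of_bound (C := C) ?_ (.of_forall fun z => ?_)
        · refine Continuous.aestronglyMeasurable ?_
          exact (Complex.continuous_conj.comp ((continuous_wave n).comp continuous_fst)).mul
            (Complex.continuous_ofReal.comp (hu.continuous.comp (by fun_prop)))
        · simpa [Function.uncurry, norm_wave] using hC (z.1 - z.2)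
    _ = ∫ y, conj (wave n y) * realCoef u n ∂heatMeasure m t := by
        congr 1
        funext y
        rw [realCoef, fourierCoef, ← hper.integral_comp_add (-y), ← integral_const_mul]
        congr 1
        funext x
        rw [wave_add, wave_neg, map_mul, Complex.conj_conj, sub_eq_add_neg]
        have : conj (wave n y) * wave n y = 1 := by
          rw [Complex.conj_mul', norm_wave]; simp
        linear_combination -(conj (wave n x) * (u (x + -y) : ℂ)) * this
    _ = _ := by rw [integral_mul_const, integral_conj_wave_heatMeasure ht]

/-! ### The exponential integrator step in Fourier variables. -/

/-- One exponential integrator step for a scalar equation, the nonlinearity being interpolated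
linearly between `p` and `q`. -/
def duhamel (ε κ τ : ℝ) (u p q : (Fin m → ℝ) → ℝ) (x : Fin m → ℝ) : ℝ :=
  Real.exp (-(κ * τ)) * scalarHeat (ε ^ 2 * τ) u x +
    ∫ s in (0 : ℝ)..τ, Real.exp (-(κ * (τ - s))) * ((1 - s / τ) * scalarHeat (ε ^ 2 * (τ - s)) p x +
      s / τ * scalarHeat (ε ^ 2 * (τ - s)) q x)

section duhamel

variable {ε κ τ : ℝ} {u p q : (Fin m → ℝ) → ℝ}

theorem continuous_duhamel_integrand (hp : ContPeriodic p) (hq : ContPeriodic q) :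
    Continuous fun z : (Fin m → ℝ) × ℝ =>
      Real.exp (-(κ * (τ - z.2))) * ((1 - z.2 / τ) * scalarHeat (ε ^ 2 * (τ - z.2)) p z.1 +
        z.2 / τ * scalarHeat (ε ^ 2 * (τ - z.2)) q z.1) := by
  have h : Continuous fun z : (Fin m → ℝ) × ℝ => (ε ^ 2 * (τ - z.2), z.1) := by fun_prop
  have h1 := hp.continuous_scalarHeat.comp h
  have h2 := hq.continuous_scalarHeat.comp h
  simp only [Function.comp_def] at h1 h2
  fun_prop

theorem contPeriodic_duhamel (hu : ContPeriodic u) (hp : ContPeriodic p) (hq : ContPeriodic q) :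
    ContPeriodic (duhamel ε κ τ u p q) where
  continuous := (continuous_const.mul (hu.scalarHeat _).continuous).add
    (intervalIntegral.continuous_parametric_intervalIntegral_of_continuous'
      (continuous_duhamel_integrand hp hq) 0 τ)
  periodic := fun k x => by
    simp only [duhamel, (hu.scalarHeat _).periodic k x, (hp.scalarHeat _).periodic k x,
      (hq.scalarHeat _).periodic k x]

/-- The symbol `κ + 4π²ε²|n|²` of `L`. -/
def symbol (ε κ : ℝ) (n : Fin m → ℤ) : ℝ := κ + ε ^ 2 * freqSq n

theorem le_symbol (ε κ : ℝ) (n : Fin m → ℤ) : κ ≤ symbol ε κ n :=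
  le_add_of_nonneg_right (mul_nonneg (sq_nonneg _) (freqSq_nonneg n))

theorem integral_weights {l : ℝ} (hτ : τ ≠ 0) (hl : l ≠ 0) (p q : ℂ) :
    ∫ s in (0 : ℝ)..τ, (Real.exp (-(l * (τ - s))) : ℂ) * ((1 - s / τ : ℝ) * p + (s / τ : ℝ) * q) =
      weight₁ τ l * p + weight₂ τ l * (q - p) := by
  have hl' : (l : ℂ) ≠ 0 := by exact_mod_cast hl
  have hτ' : (τ : ℂ) ≠ 0 := by exact_mod_cast hτ
  -- The primitive is `e^{-l(τ-s)} a(s)`, where `a` is the affine solution of `l a + a' = p +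
  -- (s/τ)(q - p)`.
  have h := intervalIntegral.integral_eq_sub_of_hasDerivAt (a := 0) (b := τ)
    (f := fun s : ℝ => Complex.exp (-(l * (τ - s))) *
      (p / l + s * ((q - p) / (τ * l)) - (q - p) / (τ * l ^ 2)))
    (f' := fun s : ℝ => (Real.exp (-(l * (τ - s))) : ℂ) *
      ((1 - s / τ : ℝ) * p + (s / τ : ℝ) * q)) (fun s _ => ?_)
    ((by fun_prop : Continuous _).intervalIntegrable _ _)
  · rw [h, weight₁, weight₂, weight₀]
    push_cast
    simp only [sub_self, mul_zero, neg_zero, Complex.exp_zero, sub_zero, zero_mul, add_zero]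
    field_simp
    ring
  · have h1 : HasDerivAt (fun s : ℝ => -((l : ℂ) * (τ - s))) l s := by
      simpa using (((Complex.ofRealCLM.hasDerivAt (x := s)).const_sub (τ : ℂ)).const_mul
        (l : ℂ)).fun_neg
    have h2 : HasDerivAt (fun s : ℝ =>
        p / l + (s : ℂ) * ((q - p) / (τ * l)) - (q - p) / (τ * l ^ 2)) ((q - p) / (τ * l)) s := by
      simpa using (((Complex.ofRealCLM.hasDerivAt (x := s)).mul_const ((q - p) / (τ * l))).const_add
        (p / l)).sub_const ((q - p) / (τ * l ^ 2))
    refine (h1.cexp.fun_mul h2).congr_deriv ?_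
    push_cast
    field_simp
    ring

/-- Taking coefficients commutes with the time integral by Fubini, and the factor `e^{-κt}` merges
with the heat multiplier into `e^{-symbol·t}`; each mode thus obeys the scalar scheme. -/
theorem realCoef_duhamel (hτ : 0 < τ) (hκ : 0 < κ) (hu : ContPeriodic u) (hp : ContPeriodic p)
    (hq : ContPeriodic q) (n : Fin m → ℤ) :
    realCoef (duhamel ε κ τ u p q) n =
      weight₀ τ (symbol ε κ n) * realCoef u n + weight₁ τ (symbol ε κ n) * realCoef p n +
        weight₂ τ (symbol ε κ n) * (realCoef q n - realCoef p n) := by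
  have hint : ∀ w : (Fin m → ℝ) → ℝ, Continuous w →
      IntegrableOn (fun x => conj (wave n x) * (w x : ℂ)) (Ω m) := fun w hw =>
    ((Complex.continuous_conj.comp (continuous_wave n)).mul
      (Complex.continuous_ofReal.comp hw)).continuousOn.integrableOn_compact isCompact_Ω
  have hlin : ∀ (a b : ℝ) (v w : (Fin m → ℝ) → ℝ), Continuous v → Continuous w →
      realCoef (fun x => a * v x + b * w x) n = a * realCoef v n + b * realCoef w n := by
    intro a b v w hv hw
    simp only [realCoef, fourierCoef]
    rw [← integral_const_mul, ← integral_const_mul,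
      ← integral_add ((hint v hv).const_mul _) ((hint w hw).const_mul _)]
    congr 1
    funext x
    push_cast
    ring
  have hexp : ∀ t : ℝ, (Real.exp (-(κ * t)) : ℂ) * Real.exp (-(freqSq n * (ε ^ 2 * t))) =
      Real.exp (-(symbol ε κ n * t)) := fun t => by
    rw [← Complex.ofReal_mul, ← Real.exp_add, symbol]
    congr 2
    ring
  have hc := continuous_duhamel_integrand (ε := ε) (κ := κ) (τ := τ) hp hq
  set g : (Fin m → ℝ) → ℝ → ℝ := fun x s =>
    Real.exp (-(κ * (τ - s))) * ((1 - s / τ) * scalarHeat (ε ^ 2 * (τ - s)) p x +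
      s / τ * scalarHeat (ε ^ 2 * (τ - s)) q x) with hg
  have hI : realCoef (fun x => ∫ s in (0 : ℝ)..τ, g x s) n =
      ∫ s in (0 : ℝ)..τ, realCoef (fun x => g x s) n := by
    simp only [realCoef, fourierCoef, intervalIntegral.integral_of_le hτ.le]
    rw [integral_integral_swap]
    · congr 1
      funext x
      rw [integral_const_mul, integral_complex_ofReal]
    · have hcont : Continuous fun z : ℝ × (Fin m → ℝ) => conj (wave n z.2) * (g z.2 z.1 : ℂ) :=
        (Complex.continuous_conj.comp ((continuous_wave n).comp continuous_snd)).mul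
          (Complex.continuous_ofReal.comp (hc.comp continuous_swap))
      have := hcont.continuousOn.integrableOn_compact (μ := volume)
        ((isCompact_Icc (a := (0 : ℝ)) (b := τ)).prod (isCompact_Ω (m := m)))
      have := this.mono_set (prod_mono_left Ioc_subset_Icc_self)
      rwa [IntegrableOn, Measure.volume_eq_prod, ← Measure.prod_restrict] at this
  have hgs : ∀ s ∈ uIcc 0 τ, realCoef (fun x => g x s) n =
      (Real.exp (-(symbol ε κ n * (τ - s))) : ℂ) *
        ((1 - s / τ : ℝ) * realCoef p n + (s / τ : ℝ) * realCoef q n) := by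
    intro s hs
    rw [uIcc_of_le hτ.le] at hs
    have ht : 0 ≤ ε ^ 2 * (τ - s) := mul_nonneg (sq_nonneg _) (by linarith [hs.2])
    have h1 : (fun x => g x s) = fun x =>
        (Real.exp (-(κ * (τ - s))) * (1 - s / τ)) * scalarHeat (ε ^ 2 * (τ - s)) p x +
          (Real.exp (-(κ * (τ - s))) * (s / τ)) * scalarHeat (ε ^ 2 * (τ - s)) q x := by
      funext x; simp only [hg]; ring
    rw [h1, hlin _ _ _ _ (hp.scalarHeat _).continuous (hq.scalarHeat _).continuous,
      realCoef_scalarHeat hp ht, realCoef_scalarHeat hq ht, ← hexp]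
    push_cast
    ring
  have h0 : duhamel ε κ τ u p q = fun x =>
      Real.exp (-(κ * τ)) * scalarHeat (ε ^ 2 * τ) u x + 1 * ∫ s in (0 : ℝ)..τ, g x s := by
    funext x; rw [duhamel, one_mul]
  rw [h0, hlin _ _ _ _ (hu.scalarHeat _).continuous
    (intervalIntegral.continuous_parametric_intervalIntegral_of_continuous' hc 0 τ), hI,
    intervalIntegral.integral_congr hgs,
    integral_weights hτ.ne' (hκ.trans_le (le_symbol ε κ n)).ne',
    realCoef_scalarHeat hu (by positivity), ← mul_assoc, hexp, weight₀]
  push_cast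
  ring

end duhamel

/-! ### Invariance of the Frobenius ball (maximum bound principle). -/

theorem norm_integral_entries_le {α : Type*} [MeasurableSpace α] {μ : Measure α} {g : α → Mat m}
    {b : α → ℝ} (hg : ∀ i j, Integrable (fun a => g a i j) μ) (hb : Integrable b μ)
    (h : ∀ᵐ a ∂μ, ‖g a‖ ≤ b a) :
    ‖(Matrix.of fun i j => ∫ a, g a i j ∂μ : Mat m)‖ ≤ ∫ a, b a ∂μ := by
  set A : Mat m := Matrix.of fun i j => ∫ a, g a i j ∂μ with hA
  have hb0 : 0 ≤ ∫ a, b a ∂μ :=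
    integral_nonneg_of_ae (h.mono fun a ha => (norm_nonneg _).trans ha)
  rcases (norm_nonneg A).eq_or_lt with h0 | h0
  · rwa [← h0]
  refine le_of_mul_le_mul_left ?_ h0
  have hi : ∀ i j, Integrable (fun a => A i j * g a i j) μ := fun i j => (hg i j).const_mul _
  -- Duality: pair the integral with itself, apply Cauchy–Schwarz under the integral sign, then
  -- divide by `‖A‖`.
  have h1 : ‖A‖ * ‖A‖ = ∫ a, frobInner A (g a) ∂μ := by
    rw [← sq, norm_sq_eq_frobInner]
    simp only [frobInner_eq_sum]
    rw [integral_finsetSum _ fun i _ => integrable_finsetSum _ fun j _ => hi i j]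
    refine Finset.sum_congr rfl fun i _ => ?_
    rw [integral_finsetSum _ fun j _ => hi i j]
    refine Finset.sum_congr rfl fun j _ => ?_
    rw [integral_const_mul]
    rfl
  rw [h1, ← integral_const_mul]
  refine integral_mono_ae ?_ (hb.const_mul _) (h.mono fun a ha => ?_)
  · simp only [frobInner_eq_sum]
    exact integrable_finsetSum _ fun i _ => integrable_finsetSum _ fun j _ => hi i j
  · exact (frobInner_le _ _).trans (mul_le_mul_of_nonneg_left ha (norm_nonneg _))

/-- Fields with continuous periodic entries. -/
def ContPeriodicField (W : Field m) : Prop := ∀ i j, ContPeriodic fun x => W x i j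

theorem InXm.contPeriodicField {U : Field m} (hU : InXm U) : ContPeriodicField U := fun i j =>
  ⟨hU.continuous i j, hU.periodic.comp fun A => A i j⟩

theorem ContPeriodicField.continuous {W : Field m} (hW : ContPeriodicField W) : Continuous W :=
  continuous_matrix fun i j => (hW i j).continuous

theorem ContPeriodicField.isPeriodic {W : Field m} (hW : ContPeriodicField W) : IsPeriodic W :=
  fun k x => by
    ext i j
    exact (hW i j).periodic k x

theorem continuous_N (κ : ℝ) : Continuous (N κ : Mat m → Mat m) := by
  unfold N f
  fun_prop

theorem ContPeriodicField.comp {W : Field m} (hW : ContPeriodicField W) {g : Mat m → Mat m}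
    (hg : Continuous g) : ContPeriodicField fun x => g (W x) := fun i j =>
  ⟨(hg.comp hW.continuous).matrix_elem i j, hW.isPeriodic.comp fun A => g A i j⟩

theorem norm_heat_le {W : Field m} (hW : ContPeriodicField W) {M : ℝ} (hM : ∀ x, ‖W x‖ ≤ M)
    (t : ℝ) (x : Fin m → ℝ) : ‖heat t W x‖ ≤ M := by
  have := norm_integral_entries_le (μ := heatMeasure m t) (g := fun y => W (x - y))
    (b := fun _ => M) (fun i j => (hW i j).integrable_comp_sub _ x) (integrable_const M)
    (.of_forall fun y => hM _)
  rwa [integral_const, probReal_univ, one_smul] at this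

/-- One exponential integrator step, the nonlinearity being interpolated linearly between
`P` and `Q`. -/
def fieldDuhamel (ε κ τ : ℝ) (U P Q : Field m) : Field m := fun x =>
  Matrix.of fun i j => duhamel ε κ τ (fun y => U y i j) (fun y => P y i j) (fun y => Q y i j) x

section steps

variable {ε κ τ : ℝ} {U P Q : Field m}

theorem contPeriodicField_fieldDuhamel (hU : ContPeriodicField U) (hP : ContPeriodicField P)
    (hQ : ContPeriodicField Q) : ContPeriodicField (fieldDuhamel ε κ τ U P Q) := fun i j =>
  contPeriodic_duhamel (hU i j) (hP i j) (hQ i j)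

/-- The heat semigroup does not increase the bound, and `e^{-κτ}M + ∫₀^τ e^{-κ(τ-s)} κM ds = M`. -/
theorem norm_fieldDuhamel_le (hτ : 0 < τ) (hU : ContPeriodicField U)
    (hP : ContPeriodicField P) (hQ : ContPeriodicField Q) {M : ℝ} (hUM : ∀ x, ‖U x‖ ≤ M)
    (hPM : ∀ x, ‖P x‖ ≤ κ * M) (hQM : ∀ x, ‖Q x‖ ≤ κ * M) (x : Fin m → ℝ) :
    ‖fieldDuhamel ε κ τ U P Q x‖ ≤ M := by
  set g : ℝ → Mat m := fun s => Real.exp (-(κ * (τ - s))) •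
    ((1 - s / τ) • heat (ε ^ 2 * (τ - s)) P x + (s / τ) • heat (ε ^ 2 * (τ - s)) Q x) with hg
  have h1 : fieldDuhamel ε κ τ U P Q x = Real.exp (-(κ * τ)) • heat (ε ^ 2 * τ) U x +
      Matrix.of fun i j => ∫ s in Ioc 0 τ, g s i j := by
    ext i j
    simp only [fieldDuhamel, Matrix.of_apply, duhamel, Matrix.add_apply, Matrix.smul_apply,
      smul_eq_mul, heat_apply, hg, intervalIntegral.integral_of_le hτ.le]
  have h2 : ‖(Matrix.of fun i j => ∫ s in Ioc 0 τ, g s i j : Mat m)‖ ≤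
      ∫ s in Ioc 0 τ, Real.exp (-(κ * (τ - s))) * (κ * M) := by
    refine norm_integral_entries_le (fun i j => ?_) ?_ ?_
    · have hc := (continuous_duhamel_integrand (ε := ε) (κ := κ) (τ := τ) (hP i j) (hQ i j)).comp
        (by fun_prop : Continuous fun s : ℝ => (x, s))
      exact (hc.integrableOn_Icc (a := 0) (b := τ)).mono_set Ioc_subset_Icc_self
    · exact ((by fun_prop : Continuous fun s : ℝ =>
        Real.exp (-(κ * (τ - s))) * (κ * M)).integrableOn_Icc (a := 0) (b := τ)).mono_set
          Ioc_subset_Icc_self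
    · filter_upwards [ae_restrict_mem measurableSet_Ioc] with s hs
      have hs0 : 0 ≤ s / τ := div_nonneg hs.1.le hτ.le
      have hs1 : 0 ≤ 1 - s / τ := by
        rw [sub_nonneg, div_le_one hτ]; exact hs.2
      rw [hg, norm_smul, Real.norm_of_nonneg (Real.exp_pos _).le]
      refine mul_le_mul_of_nonneg_left ?_ (Real.exp_pos _).le
      calc _ ≤ (1 - s / τ) * (κ * M) + s / τ * (κ * M) := by
            refine (norm_add_le _ _).trans ?_
            rw [norm_smul, norm_smul, Real.norm_of_nonneg hs0, Real.norm_of_nonneg hs1]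
            gcongr
            · exact norm_heat_le hP hPM _ _
            · exact norm_heat_le hQ hQM _ _
        _ = κ * M := by ring
  have h3 : ∫ s in Ioc 0 τ, Real.exp (-(κ * (τ - s))) * (κ * M) =
      M - Real.exp (-(κ * τ)) * M := by
    rw [← intervalIntegral.integral_of_le hτ.le]
    rw [intervalIntegral.integral_eq_sub_of_hasDerivAt
      (f := fun s => Real.exp (-(κ * (τ - s))) * M) (fun s _ => ?_)
      ((by fun_prop : Continuous _).intervalIntegrable _ _)]
    · simp
    · have : HasDerivAt (fun s : ℝ => -(κ * (τ - s))) κ s := by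
        simpa using (((hasDerivAt_id s).const_sub τ).const_mul κ).fun_neg
      exact (this.exp.mul_const M).congr_deriv (by ring)
  have h4 : ‖Real.exp (-(κ * τ)) • heat (ε ^ 2 * τ) U x‖ ≤ Real.exp (-(κ * τ)) * M := by
    rw [norm_smul, Real.norm_of_nonneg (Real.exp_pos _).le]
    exact mul_le_mul_of_nonneg_left (norm_heat_le hU hUM _ _) (Real.exp_pos _).le
  rw [h1]
  linarith [norm_add_le (Real.exp (-(κ * τ)) • heat (ε ^ 2 * τ) U x)
    (Matrix.of fun i j => ∫ s in Ioc 0 τ, g s i j : Mat m)]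

theorem etd1Step_eq (ε κ τ : ℝ) (U : Field m) :
    etd1Step ε κ τ U = fieldDuhamel ε κ τ U (fun y => N κ (U y)) fun y => N κ (U y) := by
  funext x
  ext i j
  simp only [etd1Step, expNegL, timeIntegral, fieldDuhamel, duhamel, Pi.add_apply,
    Matrix.add_apply, Matrix.smul_apply, smul_eq_mul, Matrix.of_apply, heat_apply]
  congr 2
  funext s
  ring

/-- Unlike the ETD1 identity, this splits the heat semigroup over a sum, which needs integrability
and hence the continuity and periodicity of `U`. -/
theorem etdrk2Step_eq (ε κ τ : ℝ) (hU : ContPeriodicField U) :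
    etdrk2Step ε κ τ U = fieldDuhamel ε κ τ U (fun y => N κ (U y))
      fun y => N κ (etd1Step ε κ τ U y) := by
  have hN := hU.comp (continuous_N κ)
  have hN' := (etd1Step_eq ε κ τ U ▸ contPeriodicField_fieldDuhamel hU hN hN :
    ContPeriodicField (etd1Step ε κ τ U)).comp (continuous_N κ)
  funext x
  ext i j
  simp only [etdrk2Step, expNegL, timeIntegral, fieldDuhamel, duhamel, Pi.add_apply,
    Matrix.add_apply, Matrix.smul_apply, smul_eq_mul, Matrix.of_apply, heat_apply,
    (hN i j).scalarHeat_lin (hN' i j)]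

end steps

theorem InXm.of_norm_le {W : Field m} (hW : ContPeriodicField W)
    (h : ∀ x, ‖W x‖ ≤ Real.sqrt m) : InXm W :=
  ⟨fun i j => (hW i j).continuous, hW.isPeriodic, h⟩

/-- The maximum bound principle for the ETD1 step. -/
theorem InXm.etd1Step {ε κ τ : ℝ} {U : Field m} (hU : InXm U) (hm : 1 ≤ m)
    (hκ : 3 * (m : ℝ) - 1 ≤ κ) (hτ : 0 < τ) : InXm (etd1Step ε κ τ U) := by
  have hN := hU.contPeriodicField.comp (continuous_N κ)
  have hb : ∀ x, ‖N κ (U x)‖ ≤ κ * Real.sqrt m := fun x => norm_N_le hm hκ (hU.norm_le x)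
  rw [etd1Step_eq]
  exact .of_norm_le (contPeriodicField_fieldDuhamel hU.contPeriodicField hN hN)
    (norm_fieldDuhamel_le hτ hU.contPeriodicField hN hN hU.norm_le hb hb)

/-- The maximum bound principle for the ETDRK2 step. -/
theorem InXm.etdrk2Step {ε κ τ : ℝ} {U : Field m} (hU : InXm U) (hm : 1 ≤ m)
    (hκ : 3 * (m : ℝ) - 1 ≤ κ) (hτ : 0 < τ) : InXm (etdrk2Step ε κ τ U) := by
  have hV := hU.etd1Step (ε := ε) hm hκ hτ
  have hN := hU.contPeriodicField.comp (continuous_N κ)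
  have hN' := hV.contPeriodicField.comp (continuous_N κ)
  rw [etdrk2Step_eq ε κ τ hU.contPeriodicField]
  exact .of_norm_le (contPeriodicField_fieldDuhamel hU.contPeriodicField hN hN')
    (norm_fieldDuhamel_le hτ hU.contPeriodicField hN hN' hU.norm_le
      (fun x => norm_N_le hm hκ (hU.norm_le x)) fun x => norm_N_le hm hκ (hV.norm_le x))

/-! ### Weak gradients in Fourier variables. -/

theorem wave_neg_index (n : Fin m → ℤ) (x : Fin m → ℝ) : wave (-n) x = conj (wave n x) :=
  UnitAddTorus.mFourier_neg

theorem integrableOn_mul_of_continuous {ψ g : (Fin m → ℝ) → ℂ} (hψ : Continuous ψ)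
    (hg : IntegrableOn g (Ω m)) : IntegrableOn (fun x => ψ x * g x) (Ω m) := by
  obtain ⟨C, hC⟩ := isCompact_Ω.exists_bound_of_continuousOn hψ.continuousOn
  exact hg.bdd_mul hψ.aestronglyMeasurable ((ae_restrict_mem measurableSet_Ω).mono hC)

theorem memLp_ofReal_of_continuous {u : (Fin m → ℝ) → ℝ} (hu : Continuous u) :
    MemLp (fun x => (u x : ℂ)) 2 (volume.restrict (Ω m)) := by
  obtain ⟨C, hC⟩ := isCompact_Ω.exists_bound_of_continuousOn hu.continuousOn
  refine MemLp.of_bound (Complex.continuous_ofReal.comp hu).aestronglyMeasurable C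
    ((ae_restrict_mem measurableSet_Ω).mono fun x hx => ?_)
  rw [Complex.norm_real]
  exact hC x hx

/-- A weak derivative may be tested against complex functions as well. -/
theorem integral_eq_complex_of_forall {u g : (Fin m → ℝ) → ℝ} {v : Fin m → ℝ}
    (hu : IntegrableOn u (Ω m)) (hg : IntegrableOn g (Ω m))
    (h : ∀ φ : (Fin m → ℝ) → ℝ, ContDiff ℝ ∞ φ → IsPeriodic φ →
      ∫ x in Ω m, fderiv ℝ φ x v * u x = -∫ x in Ω m, φ x * g x)
    {ψ : (Fin m → ℝ) → ℂ} (hψ : ContDiff ℝ ∞ ψ) (hp : IsPeriodic ψ) :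
    ∫ x in Ω m, fderiv ℝ ψ x v * (u x : ℂ) = -∫ x in Ω m, ψ x * (g x : ℂ) := by
  have hdc : Continuous fun x => fderiv ℝ ψ x v :=
    (hψ.continuous_fderiv (by simp)).clm_apply continuous_const
  have hd : ∀ (L : ℂ →L[ℝ] ℝ) x, fderiv ℝ (fun y => L (ψ y)) x v = L (fderiv ℝ ψ x v) :=
    fun L x => by
      have := L.hasFDerivAt.comp x (hψ.differentiable (by simp) x).hasFDerivAt
      rw [show (fun y => L (ψ y)) = L ∘ ψ from rfl, this.fderiv]
      rfl
  have h1 : IntegrableOn (fun x => fderiv ℝ ψ x v * (u x : ℂ)) (Ω m) :=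
    integrableOn_mul_of_continuous hdc hu.ofReal
  have h2 : IntegrableOn (fun x => ψ x * (g x : ℂ)) (Ω m) :=
    integrableOn_mul_of_continuous hψ.continuous hg.ofReal
  have hL := fun L : ℂ →L[ℝ] ℝ => h (fun x => L (ψ x)) (L.contDiff.comp hψ) (hp.comp L)
  have hre := hL Complex.reCLM
  have him := hL Complex.imCLM
  simp only [hd] at hre him
  rw [← integral_re_add_im h1, ← integral_re_add_im h2]
  simp only [RCLike.re_to_complex, RCLike.im_to_complex, Complex.mul_re, Complex.mul_im,
    Complex.ofReal_re, Complex.ofReal_im, mul_zero, sub_zero, zero_add,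
    Complex.reCLM_apply, Complex.imCLM_apply] at hre him ⊢
  rw [hre, him]
  push_cast
  ring

/-- The test function is `wave (-n)`; the sign from its frequency cancels the sign of the
integration by parts. -/
theorem IsWeakGradient.fourierCoef_eq {U : Field m} {G : Fin m → Field m}
    (h : IsWeakGradient U G) (k i j : Fin m) (n : Fin m → ℤ) :
    realCoef (fun x => G k x i j) n =
      2 * Real.pi * n k * Complex.I * realCoef (fun x => U x i j) n := by
  have := integral_eq_complex_of_forall (h.integrable i j) (h.integrable_grad k i j)
    (h.integral_eq k i j) (contDiff_wave (-n)) (isPeriodic_wave (-n))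
  simp only [fderiv_wave, wave_neg_index, mul_assoc _ (conj (wave n _)), integral_const_mul] at this
  simp only [realCoef, fourierCoef]
  rw [← neg_eq_iff_eq_neg.2 this]
  push_cast [Pi.neg_apply]
  ring

theorem norm_two_pi_mul_sq (a : ℤ) (z : ℂ) :
    ‖2 * Real.pi * a * Complex.I * z‖ ^ 2 = (2 * Real.pi * a) ^ 2 * ‖z‖ ^ 2 := by
  have : (2 * Real.pi * a : ℂ) = ((2 * Real.pi * a : ℝ) : ℂ) := by push_cast; ring
  rw [this, norm_mul, norm_mul, Complex.norm_I, Complex.norm_real, mul_one, mul_pow,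
    Real.norm_eq_abs, sq_abs]

/-- Parseval's identity for the Dirichlet energy. -/
theorem IsWeakGradient.hasSum_freqSq {U : Field m} {G : Fin m → Field m}
    (h : IsWeakGradient U G) (i j : Fin m)
    (hG : ∀ k, MemLp (fun x => G k x i j) 2 (volume.restrict (Ω m))) :
    HasSum (fun n => freqSq n * ‖realCoef (fun x => U x i j) n‖ ^ 2)
      (∑ k, ∫ x in Ω m, G k x i j ^ 2) := by
  have h1 : ∀ k, HasSum (fun n : Fin m → ℤ => (2 * Real.pi * n k) ^ 2 *
      ‖realCoef (fun x => U x i j) n‖ ^ 2) (∫ x in Ω m, G k x i j ^ 2) := fun k => by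
    have h2 := hasSum_norm_fourierCoef_sq (hG k).ofReal
    have h3 : ∀ n, ‖fourierCoef (fun x => ((G k x i j : ℝ) : ℂ)) n‖ ^ 2 =
        (2 * Real.pi * n k) ^ 2 * ‖realCoef (fun x => U x i j) n‖ ^ 2 := fun n => by
      rw [← norm_two_pi_mul_sq, ← h.fourierCoef_eq]
    simpa [h3] using h2
  simpa only [freqSq, Finset.sum_mul] using hasSum_sum fun k _ => h1 k

theorem fourierCoef_fderiv {φ : (Fin m → ℝ) → ℂ} (hφ : ContDiff ℝ ∞ φ) (hp : IsPeriodic φ)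
    (k : Fin m) (n : Fin m → ℤ) :
    fourierCoef (fun x => fderiv ℝ φ x (Pi.single k 1)) n =
      2 * Real.pi * n k * Complex.I * fourierCoef φ n := by
  have hper : IsPeriodic fun x => wave (-n) x * φ x := fun l x => by
    simp only [isPeriodic_wave (-n) l x, hp l x]
  have h := integral_fderiv_eq_zero hper (((contDiff_wave (-n)).mul hφ).of_le (by simp))
    (Pi.single k 1)
  have hd : ∀ x, fderiv ℝ (fun x => wave (-n) x * φ x) x (Pi.single k 1) =
      conj (wave n x) * fderiv ℝ φ x (Pi.single k 1) -
        2 * Real.pi * n k * Complex.I * (conj (wave n x) * φ x) := fun x => by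
    rw [fderiv_fun_mul ((contDiff_wave (-n)).differentiable (by simp) x)
      (hφ.differentiable (by simp) x)]
    simp only [add_apply, smul_apply, smul_eq_mul,
      fderiv_wave, wave_neg_index]
    push_cast [Pi.neg_apply]
    ring
  have hc : Continuous fun x => conj (wave n x) :=
    Complex.continuous_conj.comp (continuous_wave n)
  have hdc : Continuous fun x => fderiv ℝ φ x (Pi.single k 1) :=
    (hφ.continuous_fderiv (by simp)).clm_apply continuous_const
  simp only [hd] at h
  have i1 : IntegrableOn (fun x => conj (wave n x) * fderiv ℝ φ x (Pi.single k 1)) (Ω m) :=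
    (hc.mul hdc).continuousOn.integrableOn_compact isCompact_Ω
  have i2 : IntegrableOn (fun x => conj (wave n x) * φ x) (Ω m) :=
    (hc.mul hφ.continuous).continuousOn.integrableOn_compact isCompact_Ω
  rw [integral_sub i1 (i2.const_mul _), integral_const_mul, sub_eq_zero] at h
  exact h

theorem exists_weakDeriv {u : (Fin m → ℝ) → ℝ} (hu : Continuous u) (k : Fin m)
    (hs : Summable fun n : Fin m → ℤ => (2 * Real.pi * n k) ^ 2 * ‖realCoef u n‖ ^ 2) :
    ∃ g : (Fin m → ℝ) → ℝ, MemLp g 2 (volume.restrict (Ω m)) ∧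
      (∀ φ : (Fin m → ℝ) → ℝ, ContDiff ℝ ∞ φ → IsPeriodic φ →
        ∫ x in Ω m, fderiv ℝ φ x (Pi.single k 1) * u x = -∫ x in Ω m, φ x * g x) ∧
      ∫ x in Ω m, g x ^ 2 ≤ ∑' n : Fin m → ℤ, (2 * Real.pi * n k) ^ 2 * ‖realCoef u n‖ ^ 2 := by
  obtain ⟨g, hg, hgc⟩ := exists_fourierCoef_eq
    (c := fun n => 2 * Real.pi * n k * Complex.I * realCoef u n)
    (by simpa only [norm_two_pi_mul_sq] using hs)
  -- Riesz–Fischer gives a complex `g`. Its real part still satisfies the weak identity, because `φ`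
  -- and `u` are real, and its norm is no larger, so `g` need not be shown to be real.
  refine ⟨fun x => (g x).re, hg.re, fun φ hφ hp => ?_, ?_⟩
  · have hφ' : ContDiff ℝ ∞ fun x => (φ x : ℂ) := Complex.ofRealCLM.contDiff.comp hφ
    have hp' : IsPeriodic fun x => (φ x : ℂ) := hp.comp _
    have hd : ∀ x, fderiv ℝ (fun x => (φ x : ℂ)) x (Pi.single k 1) =
        ((fderiv ℝ φ x (Pi.single k 1) : ℝ) : ℂ) := fun x => by
      have := Complex.ofRealCLM.hasFDerivAt.comp x (hφ.differentiable (by simp) x).hasFDerivAt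
      rw [show (fun x => (φ x : ℂ)) = Complex.ofRealCLM ∘ φ from rfl, this.fderiv]
      rfl
    have hcoef := fourierCoef_fderiv hφ' hp' k
    simp only [hd] at hcoef
    have hdc : Continuous fun x => fderiv ℝ φ x (Pi.single k 1) :=
      (hφ.continuous_fderiv (by simp)).clm_apply continuous_const
    have h1 := hasSum_fourierCoef_mul (memLp_ofReal_of_continuous hdc)
      (memLp_ofReal_of_continuous hu)
    have h2 := hasSum_fourierCoef_mul (memLp_ofReal_of_continuous hφ.continuous) hg
    simp only [hcoef, hgc, Complex.conj_ofReal] at h1 h2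
    -- Parseval turns integration by parts into the antisymmetry of the multiplier: `conj (2πi n_k)
    -- = -2πi n_k`.
    have h3 := h1.unique (h2.neg.congr_fun fun n => by
      simp only [map_mul, Complex.conj_I, Complex.conj_ofReal, map_ofNat, map_intCast]
      ring)
    have h4 : IntegrableOn (fun x => (φ x : ℂ) * g x) (Ω m) :=
      integrableOn_mul_of_continuous hφ'.continuous (hg.integrable (by norm_num))
    have h5 := congrArg Complex.re h3
    have h6 : ∫ x in Ω m, φ x * (g x).re = (∫ x in Ω m, (φ x : ℂ) * g x).re := by
      have := integral_re h4
      simpa using this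
    rw [h6, ← Complex.neg_re, ← h5]
    simp only [← Complex.ofReal_mul, integral_complex_ofReal, Complex.ofReal_re]
  · have h1 := hasSum_norm_fourierCoef_sq hg
    simp only [hgc, norm_two_pi_mul_sq] at h1
    rw [h1.tsum_eq]
    refine integral_mono hg.re.integrable_sq hg.norm.integrable_sq fun x => ?_
    have := Complex.abs_re_le_norm (g x)
    exact sq_le_sq' (abs_le.1 this).1 (abs_le.1 this).2

/-- An inequality for the norms is enough: `energy` is an infimum over weak gradients, so any one of
them bounds it from above. -/
theorem exists_weakGradient {U : Field m} (hU : ContPeriodicField U)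
    (hs : ∀ i j, Summable fun n => freqSq n * ‖realCoef (fun x => U x i j) n‖ ^ 2) :
    ∃ G : Fin m → Field m, IsWeakGradient U G ∧
      (∀ k i j, MemLp (fun x => G k x i j) 2 (volume.restrict (Ω m))) ∧
      ∀ i j, ∑ k, ∫ x in Ω m, G k x i j ^ 2 ≤
        ∑' n, freqSq n * ‖realCoef (fun x => U x i j) n‖ ^ 2 := by
  have hs' : ∀ k i j, Summable fun n : Fin m → ℤ =>
      (2 * Real.pi * n k) ^ 2 * ‖realCoef (fun x => U x i j) n‖ ^ 2 := fun k i j => by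
    refine (hs i j).of_nonneg_of_le (fun n => by positivity) fun n => ?_
    refine mul_le_mul_of_nonneg_right ?_ (sq_nonneg _)
    exact Finset.single_le_sum (f := fun l => (2 * Real.pi * n l) ^ 2)
      (fun l _ => sq_nonneg _) (Finset.mem_univ k)
  choose g hg hgw hgn using fun k i j => exists_weakDeriv (hU i j).continuous k (hs' k i j)
  refine ⟨fun k x => Matrix.of fun i j => g k i j x, ⟨fun i j => ?_, fun k i j => ?_,
    fun k i j φ hφ hp => hgw k i j φ hφ hp⟩, fun k i j => hg k i j, fun i j => ?_⟩
  · exact (hU i j).continuous.continuousOn.integrableOn_compact isCompact_Ω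
  · exact (hg k i j).integrable (by norm_num)
  · simp only [freqSq, Finset.sum_mul]
    rw [Summable.tsum_finsetSum fun k _ => hs' k i j]
    exact Finset.sum_le_sum fun k _ => hgn k i j

/-! ### Energy dissipation of one step. -/

theorem integrableOn_Ω {u : (Fin m → ℝ) → ℝ} (hu : Continuous u) : IntegrableOn u (Ω m) :=
  hu.continuousOn.integrableOn_compact isCompact_Ω

theorem hasSum_realCoef_mul {u v : (Fin m → ℝ) → ℝ} (hu : Continuous u) (hv : Continuous v) :
    HasSum (fun n => (conj (realCoef u n) * realCoef v n).re) (∫ x in Ω m, u x * v x) := by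
  have h := Complex.hasSum_re
    (hasSum_fourierCoef_mul (memLp_ofReal_of_continuous hu) (memLp_ofReal_of_continuous hv))
  simpa only [Complex.conj_ofReal, ← Complex.ofReal_mul, integral_complex_ofReal,
    Complex.ofReal_re] using h

theorem hasSum_norm_realCoef_sq {u : (Fin m → ℝ) → ℝ} (hu : Continuous u) :
    HasSum (fun n => ‖realCoef u n‖ ^ 2) (∫ x in Ω m, u x ^ 2) := by
  simpa using hasSum_norm_fourierCoef_sq (memLp_ofReal_of_continuous hu)

theorem realCoef_sub {u v : (Fin m → ℝ) → ℝ} (hu : Continuous u) (hv : Continuous v)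
    (n : Fin m → ℤ) : realCoef (fun x => u x - v x) n = realCoef u n - realCoef v n := by
  have hi : ∀ w : (Fin m → ℝ) → ℝ, Continuous w →
      IntegrableOn (fun x => conj (wave n x) * (w x : ℂ)) (Ω m) := fun w hw =>
    ((Complex.continuous_conj.comp (continuous_wave n)).mul
      (Complex.continuous_ofReal.comp hw)).continuousOn.integrableOn_compact isCompact_Ω
  simp only [realCoef, fourierCoef, Complex.ofReal_sub, mul_sub]
  exact integral_sub (hi u hu) (hi v hv)

/-- The energy dissipation of the linear part of one exponential integrator step. -/
theorem duhamel_dissipation {ε κ τ : ℝ} (hτ : 0 < τ) (hκ : 0 < κ) {u p q : (Fin m → ℝ) → ℝ}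
    (hu : ContPeriodic u) (hp : ContPeriodic p) (hq : ContPeriodic q)
    (hs : Summable fun n => symbol ε κ n * ‖realCoef u n‖ ^ 2) :
    (Summable fun n => symbol ε κ n * ‖realCoef (duhamel ε κ τ u p q) n‖ ^ 2) ∧
      1 / 2 * ∑' n, symbol ε κ n * ‖realCoef (duhamel ε κ τ u p q) n‖ ^ 2 -
          1 / 2 * ∑' n, symbol ε κ n * ‖realCoef u n‖ ^ 2 ≤
        ∫ x in Ω m, ((duhamel ε κ τ u p p x - u x) * p x +
          (duhamel ε κ τ u p q x - duhamel ε κ τ u p p x) * q x) := by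
  have hl : ∀ n : Fin m → ℤ, 0 < symbol ε κ n := fun n => hκ.trans_le (le_symbol ε κ n)
  have hw := contPeriodic_duhamel (ε := ε) (κ := κ) (τ := τ) hu hp hp
  have hv := contPeriodic_duhamel (ε := ε) (κ := κ) (τ := τ) hu hp hq
  -- The uniform bound `12/l ≤ 12/κ` in `mode_bound` leaves only the plain `L²` sums of `p` and `q`.
  have hsum : Summable fun n => symbol ε κ n * ‖realCoef (duhamel ε κ τ u p q) n‖ ^ 2 := by
    have hb := (hs.mul_left 3).add
      (((hasSum_norm_realCoef_sq hp.continuous).add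
        (hasSum_norm_realCoef_sq hq.continuous)).summable.mul_left (12 / κ))
    refine hb.of_nonneg_of_le (fun n => mul_nonneg (hl n).le (sq_nonneg _)) fun n => ?_
    rw [realCoef_duhamel hτ hκ hu hp hq]
    refine (mode_bound hτ (hl n) _ _ _).trans ?_
    gcongr
    exact le_symbol ε κ n
  refine ⟨hsum, ?_⟩
  have c1 : Continuous fun x => duhamel ε κ τ u p p x - u x := hw.continuous.sub hu.continuous
  have c2 : Continuous fun x => duhamel ε κ τ u p q x - duhamel ε κ τ u p p x :=
    hv.continuous.sub hw.continuous
  have h1 := hasSum_realCoef_mul c1 hp.continuous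
  have h2 := hasSum_realCoef_mul c2 hq.continuous
  rw [integral_add (integrableOn_Ω (c1.fun_mul hp.continuous))
    (integrableOn_Ω (c2.fun_mul hq.continuous))]
  refine hasSum_le (fun n => ?_) ((hsum.hasSum.mul_left (1 / 2)).sub (hs.hasSum.mul_left (1 / 2)))
    (h1.add h2)
  have e1 : realCoef (duhamel ε κ τ u p p) n =
      weight₀ τ (symbol ε κ n) * realCoef u n + weight₁ τ (symbol ε κ n) * realCoef p n := by
    rw [realCoef_duhamel hτ hκ hu hp hp, sub_self, mul_zero, add_zero]
  rw [realCoef_sub hw.continuous hu.continuous, realCoef_sub hv.continuous hw.continuous, e1,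
    realCoef_duhamel hτ hκ hu hp hq, add_sub_cancel_left]
  exact mode_dissipation_complex hτ (hl n) _ _ _

theorem continuous_potential : Continuous fun A : Mat m => frobInner (F A) 1 := by
  simp only [frobInner_F_one]
  fun_prop

theorem potential_nonneg (A : Mat m) : 0 ≤ frobInner (F A) 1 := by
  rw [frobInner_F_one]; positivity

/-- The energy density for a given gradient. -/
def energyDensity (ε : ℝ) (U : Field m) (G : Fin m → Field m) (x : Fin m → ℝ) : ℝ :=
  ε ^ 2 / 2 * ∑ k, ‖G k x‖ ^ 2 + frobInner (F (U x)) 1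

section energyDensity

variable {ε : ℝ} {U : Field m} {G : Fin m → Field m}

theorem energyDensity_nonneg (x : Fin m → ℝ) : 0 ≤ energyDensity ε U G x :=
  add_nonneg (by positivity) (potential_nonneg _)

theorem energyDensity_eq (x : Fin m → ℝ) : energyDensity ε U G x =
    ε ^ 2 / 2 * ∑ k, ∑ i, ∑ j, G k x i j ^ 2 + frobInner (F (U x)) 1 := by
  simp only [energyDensity, norm_sq_eq_sum]

theorem integrableOn_energyDensity (hU : ContPeriodicField U)
    (hG : ∀ k i j, MemLp (fun x => G k x i j) 2 (volume.restrict (Ω m))) :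
    IntegrableOn (energyDensity ε U G) (Ω m) := by
  rw [show energyDensity ε U G = _ from funext energyDensity_eq]
  refine Integrable.add ?_ (integrableOn_Ω (continuous_potential.comp hU.continuous))
  exact (integrable_finsetSum _ fun k _ => integrable_finsetSum _ fun i _ =>
    integrable_finsetSum _ fun j _ => (hG k i j).integrable_sq).const_mul _

theorem integral_energyDensity (hU : ContPeriodicField U)
    (hG : ∀ k i j, MemLp (fun x => G k x i j) 2 (volume.restrict (Ω m))) :
    ∫ x in Ω m, energyDensity ε U G x =
      (ε ^ 2 / 2 * ∑ i, ∑ j, ∑ k, ∫ x in Ω m, G k x i j ^ 2) +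
        ∫ x in Ω m, frobInner (F (U x)) 1 := by
  have h1 : ∀ k i, IntegrableOn (fun x => ∑ j, G k x i j ^ 2) (Ω m) := fun k i =>
    integrable_finsetSum _ fun j _ => (hG k i j).integrable_sq
  have h2 : ∀ k, IntegrableOn (fun x => ∑ i, ∑ j, G k x i j ^ 2) (Ω m) := fun k =>
    integrable_finsetSum _ fun i _ => h1 k i
  have h3 : IntegrableOn (fun x => frobInner (F (U x)) 1) (Ω m) :=
    integrableOn_Ω (continuous_potential.comp hU.continuous)
  simp only [energyDensity_eq]
  rw [integral_add ((integrable_finsetSum _ fun k _ => h2 k).const_mul _) h3, integral_const_mul,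
    integral_finsetSum _ fun k _ => h2 k]
  congr 2
  calc _ = ∑ k, ∑ i, ∑ j, ∫ x in Ω m, G k x i j ^ 2 := by
        refine Finset.sum_congr rfl fun k _ => ?_
        rw [integral_finsetSum _ fun i _ => h1 k i]
        exact Finset.sum_congr rfl fun i _ =>
          integral_finsetSum _ fun j _ => (hG k i j).integrable_sq
    _ = _ := by
        rw [Finset.sum_comm]
        exact Finset.sum_congr rfl fun i _ => Finset.sum_comm

/-- The potential is nonnegative and `ε > 0`, so `2/ε²` times the energy density dominates the
square of every gradient entry. -/
theorem IsWeakGradient.memLp (hU : ContPeriodicField U) (hG : IsWeakGradient U G) (hε : 0 < ε)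
    (hfin : ∫⁻ x in Ω m, ENNReal.ofReal (energyDensity ε U G x) ≠ ⊤) (k i j : Fin m) :
    MemLp (fun x => G k x i j) 2 (volume.restrict (Ω m)) := by
  have hm : ∀ k i j, AEStronglyMeasurable (fun x => G k x i j) (volume.restrict (Ω m)) :=
    fun k i j => (hG.integrable_grad k i j).aestronglyMeasurable
  have hpm : AEStronglyMeasurable (fun x => frobInner (F (U x)) 1) (volume.restrict (Ω m)) :=
    (continuous_potential.comp hU.continuous).aestronglyMeasurable
  have hdm : AEStronglyMeasurable (energyDensity ε U G) (volume.restrict (Ω m)) := by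
    rw [show energyDensity ε U G = _ from funext energyDensity_eq]
    refine AEStronglyMeasurable.add (AEStronglyMeasurable.const_mul ?_ _) hpm
    exact Finset.aestronglyMeasurable_fun_sum _ fun k _ => Finset.aestronglyMeasurable_fun_sum _
      fun i _ => Finset.aestronglyMeasurable_fun_sum _ fun j _ => (hm k i j).pow 2
  have hint := (lintegral_ofReal_ne_top_iff_integrable hdm
    (.of_forall energyDensity_nonneg)).1 hfin
  refine (memLp_two_iff_integrable_sq (hm k i j)).2 ?_
  refine (hint.const_mul (2 / ε ^ 2)).mono' ((hm k i j).pow 2) (.of_forall fun x => ?_)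
  rw [Real.norm_of_nonneg (sq_nonneg _)]
  have h1 : G k x i j ^ 2 ≤ ∑ k, ‖G k x‖ ^ 2 := by
    calc _ ≤ ∑ j, G k x i j ^ 2 :=
          Finset.single_le_sum (f := fun j => G k x i j ^ 2) (fun _ _ => sq_nonneg _)
            (Finset.mem_univ j)
      _ ≤ ∑ i, ∑ j, G k x i j ^ 2 :=
          Finset.single_le_sum (f := fun i => ∑ j, G k x i j ^ 2)
            (fun _ _ => Finset.sum_nonneg fun _ _ => sq_nonneg _) (Finset.mem_univ i)
      _ = ‖G k x‖ ^ 2 := (norm_sq_eq_sum _).symm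
      _ ≤ _ := Finset.single_le_sum (f := fun k => ‖G k x‖ ^ 2) (fun _ _ => sq_nonneg _)
            (Finset.mem_univ k)
  have h2 : (2 / ε ^ 2) * (ε ^ 2 / 2 * ∑ k, ‖G k x‖ ^ 2) = ∑ k, ‖G k x‖ ^ 2 := by
    field_simp
  rw [energyDensity, mul_add, h2]
  exact h1.trans (le_add_of_nonneg_right (mul_nonneg (by positivity) (potential_nonneg _)))

end energyDensity

/-- A pointwise inequality for the potential and a spectral inequality for the quadratic part
together give the decay of the energy. -/
theorem energy_le_of_dissipation {ε κ : ℝ} (hε : 0 < ε) (hκ : 0 < κ) {U V : Field m}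
    (hU : ContPeriodicField U) (hV : ContPeriodicField V)
    {r : Fin m → Fin m → (Fin m → ℝ) → ℝ} (hr : ∀ i j, Continuous (r i j))
    (hpot : ∀ x, frobInner (F (V x)) 1 - frobInner (F (U x)) 1 ≤
      κ / 2 * (‖V x‖ ^ 2 - ‖U x‖ ^ 2) - ∑ i, ∑ j, r i j x)
    (hquad : ∀ i j, (Summable fun n => symbol ε κ n * ‖realCoef (fun x => U x i j) n‖ ^ 2) →
      (Summable fun n => symbol ε κ n * ‖realCoef (fun x => V x i j) n‖ ^ 2) ∧
        1 / 2 * ∑' n, symbol ε κ n * ‖realCoef (fun x => V x i j) n‖ ^ 2 -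
          1 / 2 * ∑' n, symbol ε κ n * ‖realCoef (fun x => U x i j) n‖ ^ 2 ≤
            ∫ x in Ω m, r i j x) :
    energy ε V ≤ energy ε U := by
  refine le_iInf₂ fun G hG => ?_
  change _ ≤ ∫⁻ x in Ω m, ENNReal.ofReal (energyDensity ε U G x)
  by_cases hfin : ∫⁻ x in Ω m, ENNReal.ofReal (energyDensity ε U G x) = ⊤
  · rw [hfin]; exact le_top
  have hG2 := hG.memLp hU hε hfin
  have hUsum : ∀ i j, HasSum (fun n => symbol ε κ n * ‖realCoef (fun x => U x i j) n‖ ^ 2)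
      (κ * (∫ x in Ω m, U x i j ^ 2) + ε ^ 2 * ∑ k, ∫ x in Ω m, G k x i j ^ 2) := fun i j => by
    have := ((hasSum_norm_realCoef_sq (hU i j).continuous).mul_left κ).add
      ((hG.hasSum_freqSq i j fun k => hG2 k i j).mul_left (ε ^ 2))
    simpa only [symbol, add_mul, mul_assoc] using this
  have hVs := fun i j => (hquad i j (hUsum i j).summable).1
  have hVf : ∀ i j, Summable fun n => freqSq n * ‖realCoef (fun x => V x i j) n‖ ^ 2 :=
    fun i j => by
      refine ((hVs i j).mul_left (1 / ε ^ 2)).of_nonneg_of_le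
        (fun n => mul_nonneg (freqSq_nonneg n) (sq_nonneg _)) fun n => ?_
      rw [← mul_assoc]
      refine mul_le_mul_of_nonneg_right ?_ (sq_nonneg _)
      rw [symbol, mul_add, ← mul_assoc, one_div, inv_mul_cancel₀ (by positivity), one_mul]
      exact le_add_of_nonneg_left (by positivity)
  obtain ⟨H, hH, hH2, hHle⟩ := exists_weakGradient hV hVf
  refine (iInf₂_le H hH).trans ?_
  change ∫⁻ x in Ω m, ENNReal.ofReal (energyDensity ε V H x) ≤ _
  rw [← ofReal_integral_eq_lintegral_ofReal (integrableOn_energyDensity hV hH2)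
      (.of_forall energyDensity_nonneg),
    ← ofReal_integral_eq_lintegral_ofReal (integrableOn_energyDensity hU hG2)
      (.of_forall energyDensity_nonneg)]
  refine ENNReal.ofReal_le_ofReal ?_
  rw [integral_energyDensity hV hH2, integral_energyDensity hU hG2]
  have hVt : ∀ i j, ∑' n, symbol ε κ n * ‖realCoef (fun x => V x i j) n‖ ^ 2 =
      κ * (∫ x in Ω m, V x i j ^ 2) +
        ε ^ 2 * ∑' n, freqSq n * ‖realCoef (fun x => V x i j) n‖ ^ 2 := fun i j => by
    have := ((hasSum_norm_realCoef_sq (hV i j).continuous).mul_left κ).add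
      ((hVf i j).hasSum.mul_left (ε ^ 2))
    refine HasSum.tsum_eq ?_
    simpa only [symbol, add_mul, mul_assoc] using this
  -- Splitting `symbol` into `κ` and `ε² freqSq` isolates the Dirichlet part. The leftover `κ/2`
  -- terms and the integral of `r` are exactly opposite to those in `hpotint`.
  have hentry : ∀ i j, ε ^ 2 / 2 * ∑ k, ∫ x in Ω m, H k x i j ^ 2 ≤
      (ε ^ 2 / 2 * ∑ k, ∫ x in Ω m, G k x i j ^ 2) + ((∫ x in Ω m, r i j x) -
        κ / 2 * ((∫ x in Ω m, V x i j ^ 2) - ∫ x in Ω m, U x i j ^ 2)) := fun i j => by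
    have h1 := (hquad i j (hUsum i j).summable).2
    rw [hVt, (hUsum i j).tsum_eq] at h1
    have h2 := mul_le_mul_of_nonneg_left (hHle i j) (by positivity : 0 ≤ ε ^ 2 / 2)
    linarith
  have hsq : ∀ {W : Field m}, ContPeriodicField W → ∀ i j,
      IntegrableOn (fun x => W x i j ^ 2) (Ω m) :=
    fun hW i j => integrableOn_Ω ((hW i j).continuous.pow 2)
  have hpi : ∀ {W : Field m}, ContPeriodicField W →
      IntegrableOn (fun x => frobInner (F (W x)) 1) (Ω m) :=
    fun hW => integrableOn_Ω (continuous_potential.comp hW.continuous)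
  have hdiff : ∀ i j, IntegrableOn (fun x => κ / 2 * (V x i j ^ 2 - U x i j ^ 2)) (Ω m) :=
    fun i j => ((hsq hV i j).sub (hsq hU i j)).const_mul _
  have hrhs : ∀ i j, IntegrableOn
      (fun x => κ / 2 * (V x i j ^ 2 - U x i j ^ 2) - r i j x) (Ω m) := fun i j =>
    (hdiff i j).sub (integrableOn_Ω (hr i j))
  have hpotint : (∫ x in Ω m, frobInner (F (V x)) 1) - ∫ x in Ω m, frobInner (F (U x)) 1 ≤
      ∑ i, ∑ j, (κ / 2 * ((∫ x in Ω m, V x i j ^ 2) - ∫ x in Ω m, U x i j ^ 2) -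
        ∫ x in Ω m, r i j x) := by
    rw [← integral_sub (hpi hV) (hpi hU)]
    calc _ ≤ ∫ x in Ω m, ∑ i, ∑ j, (κ / 2 * (V x i j ^ 2 - U x i j ^ 2) - r i j x) := by
          refine integral_mono ((hpi hV).sub (hpi hU)) (integrable_finsetSum _ fun i _ =>
            integrable_finsetSum _ fun j _ => hrhs i j) fun x => (hpot x).trans_eq ?_
          simp only [norm_sq_eq_sum, Finset.sum_sub_distrib, Finset.mul_sum, mul_sub]
      _ = _ := by
          rw [integral_finsetSum _ fun i _ => integrable_finsetSum _ fun j _ => hrhs i j]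
          refine Finset.sum_congr rfl fun i _ => ?_
          rw [integral_finsetSum _ fun j _ => hrhs i j]
          refine Finset.sum_congr rfl fun j _ => ?_
          rw [integral_sub (hdiff i j) (integrableOn_Ω (hr i j)), integral_const_mul,
            integral_sub (hsq hV i j) (hsq hU i j)]
  have hsum := Finset.sum_le_sum fun i (_ : i ∈ Finset.univ) =>
    Finset.sum_le_sum fun j (_ : j ∈ Finset.univ) => hentry i j
  simp only [Finset.sum_add_distrib, Finset.sum_sub_distrib, ← Finset.mul_sum] at hsum hpotint
  linarith

/-! ### The two schemes. -/

section schemes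

variable {ε κ τ : ℝ} {U : Field m}

theorem frobInner_eq_sum_sub (A B C : Mat m) :
    frobInner (A - B) C = ∑ i, ∑ j, (A i j - B i j) * C i j := by
  simp only [frobInner_eq_sum, Matrix.sub_apply]

theorem energy_etd1Step_le (hm : 1 ≤ m) (hε : 0 < ε) (hκ : 3 * (m : ℝ) - 1 ≤ κ) (hτ : 0 < τ)
    (hU : InXm U) : energy ε (etd1Step ε κ τ U) ≤ energy ε U := by
  have hκ0 : 0 < κ := by
    have : (1 : ℝ) ≤ m := by exact_mod_cast hm
    linarith
  have hV := hU.etd1Step (ε := ε) hm hκ hτ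
  have hUc := hU.contPeriodicField
  have hN := hUc.comp (continuous_N κ)
  refine energy_le_of_dissipation (κ := κ)
    (r := fun i j x => (etd1Step ε κ τ U x i j - U x i j) * N κ (U x) i j) hε hκ0 hUc
    hV.contPeriodicField (fun i j => ((hV.continuous i j).sub (hU.continuous i j)).mul
      (hN i j).continuous) (fun x => ?_) fun i j hs => ?_
  · rw [← frobInner_eq_sum_sub]
    exact potential_sub_le_N hκ (hV.norm_le x) (hU.norm_le x)
  · have h := duhamel_dissipation hτ hκ0 (hUc i j) (hN i j) (hN i j) hs
    simp only [sub_self, zero_mul, add_zero] at h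
    rw [etd1Step_eq]
    exact h

theorem energy_etdrk2Step_le (hm : 1 ≤ m) (hε : 0 < ε) (hκ : 3 * (m : ℝ) - 1 ≤ κ) (hτ : 0 < τ)
    (hU : InXm U) : energy ε (etdrk2Step ε κ τ U) ≤ energy ε U := by
  have hκ0 : 0 < κ := by
    have : (1 : ℝ) ≤ m := by exact_mod_cast hm
    linarith
  have hW := hU.etd1Step (ε := ε) hm hκ hτ
  have hV := hU.etdrk2Step (ε := ε) hm hκ hτ
  have hUc := hU.contPeriodicField
  have hN := hUc.comp (continuous_N κ)
  have hN' := hW.contPeriodicField.comp (continuous_N κ)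
  refine energy_le_of_dissipation (κ := κ)
    (r := fun i j x => (etd1Step ε κ τ U x i j - U x i j) * N κ (U x) i j +
      (etdrk2Step ε κ τ U x i j - etd1Step ε κ τ U x i j) * N κ (etd1Step ε κ τ U x) i j)
    hε hκ0 hUc hV.contPeriodicField (fun i j =>
      (((hW.continuous i j).sub (hU.continuous i j)).mul (hN i j).continuous).add
        (((hV.continuous i j).sub (hW.continuous i j)).mul (hN' i j).continuous))
    (fun x => ?_) fun i j hs => ?_
  · simp only [Finset.sum_add_distrib]
    rw [← frobInner_eq_sum_sub, ← frobInner_eq_sum_sub]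
    -- Adding the inequalities for `U` to predictor and predictor to new iterate makes the `κ/2`
    -- norm terms telescope.
    linarith [potential_sub_le_N hκ (hW.norm_le x) (hU.norm_le x),
      potential_sub_le_N hκ (hV.norm_le x) (hW.norm_le x)]
  · have h := duhamel_dissipation hτ hκ0 (hUc i j) (hN i j) (hN' i j) hs
    have e1 : (fun x => etd1Step ε κ τ U x i j) = duhamel ε κ τ (fun y => U y i j)
        (fun y => N κ (U y) i j) fun y => N κ (U y) i j := by
      rw [etd1Step_eq]; rfl
    have e2 : (fun x => etdrk2Step ε κ τ U x i j) = duhamel ε κ τ (fun y => U y i j)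
        (fun y => N κ (U y) i j) fun y => N κ (etd1Step ε κ τ U y) i j := by
      rw [etdrk2Step_eq ε κ τ hUc]; rfl
    rw [← e1, ← e2] at h
    exact h

theorem InXm.etd1 (hU : InXm U) (hm : 1 ≤ m) (hκ : 3 * (m : ℝ) - 1 ≤ κ) (hτ : 0 < τ) :
    ∀ n, InXm (etd1 ε κ τ U n)
  | 0 => hU
  | n + 1 => (InXm.etd1 hU hm hκ hτ n).etd1Step hm hκ hτ

theorem InXm.etdrk2 (hU : InXm U) (hm : 1 ≤ m) (hκ : 3 * (m : ℝ) - 1 ≤ κ) (hτ : 0 < τ) :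
    ∀ n, InXm (etdrk2 ε κ τ U n)
  | 0 => hU
  | n + 1 => (InXm.etdrk2 hU hm hκ hτ n).etdrk2Step hm hκ hτ

end schemes

end MatrixAllenCahn

end

theorem mainTheorem3 (m : ℕ) (hm : 2 ≤ m) (ε κ τ : ℝ) (hε : 0 < ε)
    (hκ : 3 * (m : ℝ) - 1 ≤ κ) (hτ : 0 < τ) :
    (∀ U₀ : MatrixAllenCahn.Field m, MatrixAllenCahn.InXm U₀ →
      (∀ n : ℕ, MatrixAllenCahn.energy ε (MatrixAllenCahn.etd1 ε κ τ U₀ (n + 1)) ≤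
        MatrixAllenCahn.energy ε (MatrixAllenCahn.etd1 ε κ τ U₀ n)) ∧
      (∀ n : ℕ, MatrixAllenCahn.energy ε (MatrixAllenCahn.etdrk2 ε κ τ U₀ (n + 1)) ≤
        MatrixAllenCahn.energy ε (MatrixAllenCahn.etdrk2 ε κ τ U₀ n))) ∧
    (∀ U₁ U₂ : MatrixAllenCahn.Mat m, ‖U₁‖ ≤ Real.sqrt m → ‖U₂‖ ≤ Real.sqrt m →
      MatrixAllenCahn.frobInner (MatrixAllenCahn.F U₁ - MatrixAllenCahn.F U₂) 1 +
        MatrixAllenCahn.frobInner (U₁ - U₂) (MatrixAllenCahn.f U₂) ≤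
      κ / 2 * ‖U₁ - U₂‖ ^ 2) := by
  have hm1 : 1 ≤ m := by omega
  refine ⟨fun U₀ hU => ⟨fun n => ?_, fun n => ?_⟩, fun U₁ U₂ h₁ h₂ =>
    MatrixAllenCahn.potential_sub_le hκ h₁ h₂⟩
  · exact MatrixAllenCahn.energy_etd1Step_le hm1 hε hκ hτ (hU.etd1 hm1 hκ hτ n)
  · exact MatrixAllenCahn.energy_etdrk2Step_le hm1 hε hκ hτ (hU.etdrk2 hm1 hκ hτ n)
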